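/- **Networks.** A network $\mathcal G$ has a finite set $\mathcal C$ of nodes and a finite set of arrows, each node having a node-type and each arrow $a$ an arrow-type, a head node $\mathcal H(a)$ and a tail node $\mathcal T(a)$ (loops and multiple arrows are allowed). $I(c)$ is the set of arrows with head $c$. An input isomorphism from $c$ to $d$ (nodes of the same node-type) is an arrow-type preserving bijection $\beta:I(c)\to I(d)$; the set of these is $B(c,d)$. State equivalence is the equivalence relation on $\mathcal C$ generated by $c\sim d$ and $\mathcal T(a)\sim\mathcal T(\beta(a))$ for all $\beta\in B(c,d)$, $a\in I(c)$. Node spaces are $P_c=\mathbb R^{k_c}$ with $k_c\ge 1$ and $P_c=P_d$ for state equivalent $c,d$; put $P=\prod_c P_c$ with norm $\|x\|=\max_c\|x_c\|_E$, where $\|\cdot\|_E$ is the Euclidean norm. A map $f:P\to P$ is admissible if for each $c$ there is a function $\hat f_c$ with $f_c(x)=\hat f_c(x_c,(x_{\mathcal T(a)})_{a\in I(c)})$, such that $\hat f_d(x_d,(x_{\mathcal T(b)})_{b\in I(d)})=\hat f_c(x_d,(x_{\mathcal T(\beta(a))})_{a\in I(c)})$ for all $c,d$, $\beta\in B(c,d)$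 and $x\in P$. $\mathcal G$ is transitive if any two nodes are joined by a directed path. **Perturbations.** A perturbation of size $<\varepsilon$ is a $C^\infty$ admissible map $p:P\to P$ with $\|p\|_1=\sup_{x}\max(\|p(x)\|,\|\mathrm Dp(x)\|)<\varepsilon$. **Periodic orbits.** A periodic orbit of $\dot x=f(x)$ with period $T>0$ is a nonconstant solution $x:\mathbb R\to P$ with $x(t+T)=x(t)$ for all $t$. It is hyperbolic if exactly one of its Floquet multipliers (counted with algebraic multiplicity) lies on the unit circle, this one being $1$. A periodic orbit $y$ with period $S$ is $\delta$-near $x$ if $|S-T|<\delta$ and, for some $\tau$, $\|y(\tau+St)-x(Tt)\|<\delta$ for all $t\in\mathbb R$. **Strong hyperbolicity.** A colouring is an equivalence relation $\bowtie$ on $\mathcal C$ with $c\bowtie d$ only if $c,d$ are state equivalent. For a set of representatives $\mathcal R$ of $\bowtie$ let $[c]\in\mathcal R$ be the representative of $c$. The induced ODE of $f$ on $\prod_{r\in\mathcal R}P_r$ is $\dot u_r=f_r\big((u_{[c]})_{c\in\mathcal C}\big)$, $r\in\mathcal R$. The periodic orbit $x$ of $f$ has the synchronies of $\bowtie$ rigidly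 if there are $\varepsilon,\delta>0$ such that for every perturbation $p$ of size $<\varepsilon$ and every periodic orbit $y$ of $\dot y=(f+p)(y)$ that is $\delta$-near $x$, $c\bowtie d$ implies $y_c(t)=y_d(t)$ for all $t$. The orbit $x$ is strongly hyperbolic if it is hyperbolic and, for every colouring $\bowtie$ whose synchronies it has rigidly, there is a set $\mathcal R$ of representatives such that for every $\varepsilon>0$ there are a perturbation $p$ of size $<\varepsilon$ and a periodic orbit $y$ of $f+p$ that is $\varepsilon$-near $x$, for which $(y_r)_{r\in\mathcal R}$ is a hyperbolic periodic orbit of the induced ODE of $f+p$. **Theorem (Full Oscillation Property).** Let $\mathcal G$ be a transitive network, $f:P\to P$ a $C^\infty$ admissible map, and $x$ a strongly hyperbolic periodic orbit of $\dot x=f(x)$ with period $T$. Then there are arbitrarily small admissible perturbations for which every node oscillates on the perturbed periodic orbit. Precisely: there is $\delta>0$ such that for every $\varepsilon>0$ there is a perturbation $p$ of size $<\varepsilon$ for which $\dot y=(f+p)(y)$ has, up to time translation, exactly one periodic orbit $y$ that is $\delta$-near $x$; this orbit is also $\varepsilon$-near $x$, and $y_c$ is nonconstant for every node $c\in\mathcal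 C$. -/

import Mathlib

open scoped ContDiff

noncomputable section

/-! ## Orbits of vector fields on a finite-dimensional space -/

section Orbits

variable {E : Type*} [NormedAddCommGroup E] [NormedSpace ℝ E]

/-- `x` is a periodic solution, with period `T`, of `ẋ = g(x)`, and it is not an equilibrium.
The period `T` is not required to be the minimal one. -/
structure IsPeriodicOrbit (g : E → E) (x : ℝ → E) (T : ℝ) : Prop where
  pos : 0 < T
  solves : ∀ t, HasDerivAt x (g (x t)) t
  periodic : ∀ t, x (t + T) = x t
  nonconstant : ∃ t s, x t ≠ x s

/-- A hyperbolic periodic orbit.  The fundamental matrix `Φ` of the variational equation along the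
orbit gives the monodromy operator `Φ T`, whose complex eigenvalues are the Floquet multipliers.
Exactly one of them, counted with algebraic multiplicity, lies on the unit circle, namely `1`. -/
structure IsHyperbolicOrbit [FiniteDimensional ℝ E] (g : E → E) (x : ℝ → E) (T : ℝ) : Prop where
  orbit : IsPeriodicOrbit g x T
  floquet : ∃ Φ : ℝ → (E →L[ℝ] E),
    Φ 0 = ContinuousLinearMap.id ℝ E ∧
    (∀ t, HasDerivAt Φ ((fderiv ℝ g (x t)).comp (Φ t)) t) ∧
    (Φ T : E →ₗ[ℝ] E).charpoly.rootMultiplicity 1 = 1 ∧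
    ∀ z : ℂ, ((Φ T : E →ₗ[ℝ] E).charpoly.map (algebraMap ℝ ℂ)).IsRoot z → ‖z‖ = 1 → z = 1

/-- The orbit `y` with period `S` is `δ`-close to the orbit `x` with period `T`: the periods are
`δ`-close, and so are the orbits when both are run through once in unit time, from suitable
starting points. -/
def OrbitNear (δ : ℝ) (x : ℝ → E) (T : ℝ) (y : ℝ → E) (S : ℝ) : Prop :=
  |S - T| < δ ∧ ∃ τ : ℝ, ∀ t : ℝ, ‖y (τ + S * t) - x (T * t)‖ < δ

/-- The `C¹` norm `sup_x max(‖p(x)‖, ‖Dp(x)‖)` of a differentiable map, as an extended real. -/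
def c1Norm (p : E → E) : ENNReal := ⨆ x : E, max ‖p x‖ₑ ‖fderiv ℝ p x‖ₑ

end Orbits

/-! ## Networks -/

/-- A network with set of nodes `C` and set of arrows `A`. Loops and multiple arrows are allowed. -/
structure Network (C A : Type*) where
  /-- having the same node-type -/
  nodeType : Setoid C
  /-- having the same arrow-type -/
  arrowType : Setoid A
  head : A → C
  tail : A → C

namespace Network

variable {C A : Type*} (G : Network C A)

/-- The input set of a node: all arrows with that head. -/
def InputSet (c : C) : Type _ := {a : A // G.head a = c}

/-- The tail node of an input arrow. -/
def InputSet.tail {G : Network C A} {c : C} (a : G.InputSet c) : C := G.tail a.1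

/-- Input isomorphisms from `c` to `d`: arrow-type preserving bijections of the input sets of two
nodes of the same node-type. -/
structure InputIso (c d : C) where
  toEquiv : G.InputSet c ≃ G.InputSet d
  node_rel : G.nodeType.r c d
  arrow_rel : ∀ a : G.InputSet c, G.arrowType.r a.1 (toEquiv a).1

/-- State equivalence: the equivalence relation generated by the equalities of node spaces that
input isomorphisms force. -/
inductive StateEquiv : C → C → Prop
  | head {c d : C} (β : G.InputIso c d) : StateEquiv c d
  | tail {c d : C} (β : G.InputIso c d) (a : G.InputSet c) :
      StateEquiv a.tail (β.toEquiv a).tail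
  | refl (c : C) : StateEquiv c c
  | symm {c d : C} : StateEquiv c d → StateEquiv d c
  | trans {c d e : C} : StateEquiv c d → StateEquiv d e → StateEquiv c e

/-- Any two nodes are joined by a directed path. -/
def IsTransitive : Prop :=
  ∀ c d : C, Relation.ReflTransGen (fun i j => ∃ a : A, G.tail a = i ∧ G.head a = j) c d

/-- A choice of node spaces `P c = ℝ^(dim c)`, the same for state equivalent nodes. -/
structure NodeSpaces where
  dim : C → ℕ
  compat : ∀ {c d : C}, G.StateEquiv c d → dim c = dim d

variable {G}

namespace NodeSpaces

variable (V : G.NodeSpaces)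

/-- The node space of `c`, with its Euclidean norm. -/
abbrev P (c : C) : Type := EuclideanSpace ℝ (Fin (V.dim c))

/-- The state space: the product of the node spaces, with the maximum of the Euclidean norms. -/
abbrev State : Type _ := ∀ c : C, V.P c

/-- The identification of the (equal) node spaces of state equivalent nodes. -/
def ident {c d : C} (h : G.StateEquiv c d) : V.P c ≃ₗᵢ[ℝ] V.P d :=
  LinearIsometryEquiv.piLpCongrLeft 2 ℝ ℝ (finCongr (V.compat h))

/-- Admissible maps. The component of `f` at the node `c` is a function `fhat c` of the state of `c`
and the states of the tails of its input arrows (domain condition), and these functions are related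
by all input isomorphisms (pullback condition). -/
def IsAdmissible (f : V.State → V.State) : Prop :=
  ∃ fhat : ∀ c : C, V.P c → (∀ a : G.InputSet c, V.P a.tail) → V.P c,
    (∀ (c : C) (x : V.State), f x c = fhat c (x c) (fun a => x a.tail)) ∧
    ∀ (c d : C) (β : G.InputIso c d) (x : V.State),
      fhat d (x d) (fun b => x b.tail) =
        V.ident (.head β) (fhat c ((V.ident (.head β)).symm (x d))
          (fun a => (V.ident (.tail β a)).symm (x (β.toEquiv a).tail)))

variable [Fintype C]

/-- `p` is a smooth admissible map with `C¹` norm less than `ε`. -/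
structure IsPerturbation (p : V.State → V.State) (ε : ℝ) : Prop where
  admissible : V.IsAdmissible p
  smooth : ContDiff ℝ ∞ p
  small : c1Norm p < ENNReal.ofReal ε

end NodeSpaces

/-! ## Colourings, induced equations, strong hyperbolicity -/

/-- A colouring of the nodes; nodes of the same colour have the same node space. -/
structure Colouring (G : Network C A) where
  rel : Setoid C
  stateEquiv : ∀ {c d : C}, rel.r c d → G.StateEquiv c d

/-- A set `R` of representatives for a colouring; `bracket c` is the representative of the
colour of `c`. -/
structure Colouring.Representatives (K : Colouring G) where
  R : Finset C
  bracket : C → C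
  bracket_mem : ∀ c, bracket c ∈ R
  bracket_rel : ∀ c, K.rel.r (bracket c) c
  eq_bracket : ∀ r ∈ R, ∀ c, K.rel.r r c → r = bracket c

namespace NodeSpaces

variable (V : G.NodeSpaces) {K : Colouring G} (ρ : K.Representatives)

/-- The state space of the quasi-quotient: the product of the node spaces of representatives. -/
abbrev RepState : Type _ := ∀ r : ρ.R, V.P r

/-- The point of the synchrony space of the colouring with the given coordinates at the
representatives: the state of `c` is the state of its representative. -/
def lift (u : V.RepState ρ) : V.State :=
  fun c => V.ident (K.stateEquiv (ρ.bracket_rel c)) (u ⟨ρ.bracket c, ρ.bracket_mem c⟩)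

/-- The vector field of the induced equation: in the components of `f` at the representatives,
every node variable is replaced by that of its representative. -/
def induced (f : V.State → V.State) : V.RepState ρ → V.RepState ρ :=
  fun u r => f (V.lift ρ u) r

variable [Fintype C]

/-- The orbit `x` lies rigidly in the synchrony space of the colouring `K`: for all sufficiently
small admissible perturbations, nodes of the same colour are synchronous on the perturbed periodic
orbit. -/
def RigidlySynchronous (K : Colouring G) (f : V.State → V.State) (x : ℝ → V.State) (T : ℝ) :
    Prop :=
  ∃ ε > 0, ∃ δ > 0, ∀ p, V.IsPerturbation p ε →
    ∀ y S, IsPeriodicOrbit (f + p) y S → OrbitNear δ x T y S →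
      ∀ (c d : C) (h : K.rel.r c d) (t : ℝ), V.ident (K.stateEquiv h) (y t c) = y t d

/-- Strong hyperbolicity for a colouring: the orbit is hyperbolic and, for some set of
representatives, after an arbitrarily small admissible perturbation the induced orbit
(the projection of the perturbed periodic orbit to the representatives) is a hyperbolic periodic
orbit of the induced equation. -/
def StronglyHyperbolicFor (K : Colouring G) (f : V.State → V.State) (x : ℝ → V.State) (T : ℝ) :
    Prop :=
  IsHyperbolicOrbit f x T ∧
    ∃ ρ : K.Representatives, ∀ ε > 0, ∃ p, V.IsPerturbation p ε ∧
      ∃ y S, IsPeriodicOrbit (f + p) y S ∧ OrbitNear ε x T y S ∧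
        IsHyperbolicOrbit (V.induced ρ (f + p)) (fun t r => y t r) S

/-- Strong hyperbolicity: hyperbolicity, and strong hyperbolicity for every colouring for which the
induced orbit is defined, that is, for which the orbit has the corresponding synchronies rigidly. -/
def StronglyHyperbolic (f : V.State → V.State) (x : ℝ → V.State) (T : ℝ) : Prop :=
  IsHyperbolicOrbit f x T ∧
    ∀ K : Colouring G, V.RigidlySynchronous K f x T → V.StronglyHyperbolicFor K f x T

end NodeSpaces

end Network

end

/-! A periodic orbit run through once in unit time is a pair (u, S) of a curve on [0, 1] and a
period, with u(t) - u(1) - S ∫₀ᵗ g(u) = 0 and a phase condition: a zero of `periodMap`. At a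
hyperbolic orbit the simplicity of the multiplier 1 makes the linearization bijective
(`bijective_linearPeriodMap`). Hence on one fixed ball the period maps of all C¹ small perturbations
are expanding with a common constant, and each has exactly one zero
(`IsHyperbolicOrbit.exists_persistence`).

The decisive point is a gap between two norms. The period map sees a perturbation only through its
primitive along the curve, so the orbit moves by at most a constant times the mean of the
perturbation along it. Steadiness of a node, however, is a pointwise condition: its component of the
vector field vanishes all along the orbit. If a node is steady both before and after adding s • q,
then at each time s |q_c| is balanced by the change of the old component, which is at most a
constant times s times the mean of ‖q‖. A map q that is large in component c at one point of the
orbit but small in the mean therefore makes c oscillate for small s > 0 (`eventually_not_steady`).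

Such an admissible q exists as soon as one input of c oscillates (`exists_localized_field`). The
input state of c then takes uncountably many values. For each of the finitely many curves of input
states transported to c by input isomorphisms, only countably many values are attained on sets of
positive measure. A narrow bump at one of the remaining values, symmetrized over input isomorphisms,
has arbitrarily small mean but size at least 1 at one point of the orbit.

Finally, choose among the small perturbations one whose set of oscillating nodes is maximal. It is
nonempty, because the orbit is nonconstant; if it were not everything, transitivity would give an
arrow from an oscillating node to a steady one, and the step above would enlarge the set, since
oscillating nodes keep oscillating under small changes. -/

section

open Set Metric Filter Topology MeasureTheory

/-! ### Quantitative inverse function estimates -/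

section BanachStep

/-- Quantitative perturbation of a linear equivalence: maps uniformly close to `A` in the Lipschitz
sense on a ball are expanding there and have a zero as soon as the value at the centre is small. -/
theorem ContinuousLinearEquiv.exists_perturbation_bounds {X : Type*} [NormedAddCommGroup X]
    [NormedSpace ℝ X] [CompleteSpace X] (A : X ≃L[ℝ] X) :
    ∃ c > 0, ∃ K > 0, ∀ (G : X → X) (w₀ : X) (ρ : ℝ), 0 ≤ ρ →
      (∀ w₁ ∈ closedBall w₀ ρ, ∀ w₂ ∈ closedBall w₀ ρ,
        ‖G w₁ - G w₂ - A (w₁ - w₂)‖ ≤ c * ‖w₁ - w₂‖) →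
      (∀ w₁ ∈ closedBall w₀ ρ, ∀ w₂ ∈ closedBall w₀ ρ, ‖w₁ - w₂‖ ≤ K * ‖G w₁ - G w₂‖) ∧
      (K * ‖G w₀‖ ≤ ρ → ∃ w ∈ closedBall w₀ ρ, G w = 0) := by
  -- The added 1 keeps `N` positive even when the inverse has norm 0.
  set N : NNReal := ‖(A.symm : X →L[ℝ] X)‖₊ + 1 with hN
  have hNpos : (0 : ℝ) < N := by rw [hN]; push_cast; positivity
  have hsymm : ∀ y, ‖A.symm y‖ ≤ N * ‖y‖ := fun y => by
    refine ((A.symm : X →L[ℝ] X).le_opNorm y).trans ?_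
    gcongr
    rw [hN]; push_cast; simp
  refine ⟨(2 * N)⁻¹, by positivity, 2 * N, by positivity, fun G w₀ ρ hρ hG => ⟨?_, ?_⟩⟩
  · intro w₁ h₁ w₂ h₂
    have h := hG w₁ h₁ w₂ h₂
    have h' : ‖w₁ - w₂‖ ≤ N * ‖A (w₁ - w₂)‖ := by
      simpa using hsymm (A (w₁ - w₂))
    have h'' : ‖A (w₁ - w₂)‖ ≤ ‖G w₁ - G w₂‖ + (2 * (N : ℝ))⁻¹ * ‖w₁ - w₂‖ := by
      have := norm_sub_norm_le (A (w₁ - w₂)) (G w₁ - G w₂)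
      rw [norm_sub_rev (A (w₁ - w₂))] at this
      linarith
    have h3 : (N : ℝ) * ‖A (w₁ - w₂)‖ ≤ N * ‖G w₁ - G w₂‖ + 1 / 2 * ‖w₁ - w₂‖ := by
      calc (N : ℝ) * ‖A (w₁ - w₂)‖ ≤ N * (‖G w₁ - G w₂‖ + (2 * (N : ℝ))⁻¹ * ‖w₁ - w₂‖) := by gcongr
        _ = _ := by field_simp
    linarith
  · intro hw
    let R : (A : X →L[ℝ] X).NonlinearRightInverse :=
      { toFun := A.symm
        nnnorm := N
        bound' := hsymm
        right_inv' := fun y => A.apply_symm_apply y }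
    have happ : ApproximatesLinearOn G (A : X →L[ℝ] X) (closedBall w₀ ρ) ((2 * N)⁻¹) := by
      intro a ha b hb
      simpa using hG a ha b hb
    -- The image of the ball contains the ball around `G w₀` of radius (1/N - 1/(2N)) ρ = ρ/(2N),
    -- which contains 0 by the assumption on `G w₀`.
    have hs := happ.surjOn_closedBall_of_nonlinearRightInverse R hρ subset_rfl
    have hmem : (0 : X) ∈ closedBall (G w₀)
        ((((R.nnnorm : NNReal) : ℝ)⁻¹ - (((2 * N)⁻¹ : NNReal) : ℝ)) * ρ) := by
      rw [mem_closedBall, dist_zero_left]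
      change ‖G w₀‖ ≤ ((N : ℝ)⁻¹ - (((2 * N)⁻¹ : NNReal) : ℝ)) * ρ
      have e : ((N : ℝ)⁻¹ - (((2 * N)⁻¹ : NNReal) : ℝ)) = (2 * (N : ℝ))⁻¹ := by
        push_cast; field_simp; norm_num
      rw [e, inv_mul_eq_div, le_div_iff₀ (by positivity)]
      linarith
    obtain ⟨w, hw, h0⟩ := hs hmem
    exact ⟨w, hw, h0⟩

end BanachStep

/-! ### Bordered operators at a simple eigenvalue -/

section SimpleEigenvalue

/-- If `1` is an algebraically simple eigenvalue of `M` with eigenvector `e`, the bordered operator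
`(v, σ) ↦ ((M - 1) v + σ e, ℓ v)` with `ℓ e = 1` is bijective. -/
theorem bijective_bordered_of_rootMultiplicity_eq_one {E : Type*} [NormedAddCommGroup E]
    [NormedSpace ℝ E] [FiniteDimensional ℝ E] (M : E →ₗ[ℝ] E) (e : E) (l : E →ₗ[ℝ] ℝ)
    (hM : M.charpoly.rootMultiplicity 1 = 1) (he : M e = e) (hl : l e = 1) :
    Function.Bijective (fun w : E × ℝ => (M w.1 - w.1 + w.2 • e, l w.1)) := by
  let N : E × ℝ →ₗ[ℝ] E × ℝ :=
    ((M - LinearMap.id).comp (LinearMap.fst ℝ E ℝ) +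
      (LinearMap.toSpanSingleton ℝ E e).comp (LinearMap.snd ℝ E ℝ)).prod
      (l.comp (LinearMap.fst ℝ E ℝ))
  have hN : (fun w : E × ℝ => (M w.1 - w.1 + w.2 • e, l w.1)) = N := by
    ext w <;> simp [N]
  rw [hN]
  have hinj : Function.Injective N := by
    rw [injective_iff_map_eq_zero]
    rintro ⟨v, σ⟩ hv
    have h1 : M v - v + σ • e = 0 := by simpa [N] using congrArg Prod.fst hv
    have h2 : l v = 0 := by simpa [N] using congrArg Prod.snd hv
    have hrank := LinearMap.finrank_maxGenEigenspace_eq (K := ℝ) M 1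
    rw [hM] at hrank
    have he0 : e ≠ 0 := by rintro rfl; simp at hl
    have hemem : e ∈ Module.End.maxGenEigenspace M 1 := by
      rw [Module.End.mem_maxGenEigenspace]
      exact ⟨1, by simp [he]⟩
    have hMv : M v = v - σ • e := by
      rw [eq_sub_iff_add_eq, ← sub_eq_zero, ← h1]; abel
    -- Since (M - 1) v = -σ e and (M - 1) e = 0, the square of M - 1 kills v. The generalized
    -- eigenspace is the line through e, so v is a multiple of e, and `l v = 0` makes it zero.
    have hvmem : v ∈ Module.End.maxGenEigenspace M 1 := by
      rw [Module.End.mem_maxGenEigenspace]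
      exact ⟨2, by simp [pow_two, hMv, he, map_smul]⟩
    obtain ⟨r, hr⟩ := (finrank_eq_one_iff_of_nonzero' (K := ℝ)
      (⟨e, hemem⟩ : Module.End.maxGenEigenspace M 1) (by simpa using he0)).1 hrank ⟨v, hvmem⟩
    have hr' : r • e = v := congrArg Subtype.val hr
    have hr0 : r = 0 := by
      rw [← hr', map_smul, hl] at h2; simpa using h2
    have hv0 : v = 0 := by rw [← hr', hr0, zero_smul]
    have hσ : σ = 0 := by
      rw [hv0] at h1
      simpa [he0] using h1
    simp [hv0, hσ]
  exact ⟨hinj, LinearMap.injective_iff_surjective.1 hinj⟩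

end SimpleEigenvalue

/-! ### Linear differential equations -/

section LinearODE

variable {E : Type*} [NormedAddCommGroup E] [NormedSpace ℝ E]

theorem hasDerivAt_clm_apply_of_fundamental {B Φ : ℝ → E →L[ℝ] E}
    (hΦ : ∀ t, HasDerivAt Φ ((B t).comp (Φ t)) t) (v : E) (t : ℝ) :
    HasDerivAt (fun t => Φ t v) (B t (Φ t v)) t := by
  simpa using (hΦ t).clm_apply (hasDerivAt_const t v)

/-- Solutions of a linear equation with bounded coefficients are given by the fundamental matrix. -/
theorem eq_fundamental_apply {B Φ : ℝ → E →L[ℝ] E} {L : ℝ} (hB : ∀ t, ‖B t‖ ≤ L)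
    (hΦ0 : Φ 0 = ContinuousLinearMap.id ℝ E) (hΦ : ∀ t, HasDerivAt Φ ((B t).comp (Φ t)) t)
    {w : ℝ → E} (hw : ∀ t, HasDerivAt w (B t (w t)) t) (t : ℝ) : w t = Φ t (w 0) := by
  have hLip : ∀ t, LipschitzOnWith L.toNNReal (fun y => B t y) univ := fun t => by
    refine ((B t).lipschitz.weaken ?_).lipschitzOnWith
    rw [← NNReal.coe_le_coe]
    simpa using (hB t).trans (Real.le_coe_toNNReal L)
  have := ODE_solution_unique_univ (v := fun t y => B t y) (s := fun _ => univ) (t₀ := 0)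
    hLip (fun t => ⟨hw t, trivial⟩)
    (fun t => ⟨hasDerivAt_clm_apply_of_fundamental hΦ (w 0) t, trivial⟩) (by simp [hΦ0])
  exact congrFun this t

/-- A solution that vanishes at one time vanishes identically, in particular at time 0; so `Φ t` is
injective, and the dimension is finite. -/
theorem isUnit_fundamental [FiniteDimensional ℝ E] {B Φ : ℝ → E →L[ℝ] E} {L : ℝ}
    (hB : ∀ t, ‖B t‖ ≤ L) (hΦ0 : Φ 0 = ContinuousLinearMap.id ℝ E)
    (hΦ : ∀ t, HasDerivAt Φ ((B t).comp (Φ t)) t) (t : ℝ) : IsUnit (Φ t) := by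
  have hLip : ∀ t, LipschitzOnWith L.toNNReal (fun y => B t y) univ := fun t => by
    refine ((B t).lipschitz.weaken ?_).lipschitzOnWith
    rw [← NNReal.coe_le_coe]
    simpa using (hB t).trans (Real.le_coe_toNNReal L)
  have hinj : Function.Injective (Φ t) := by
    rw [injective_iff_map_eq_zero]
    intro v hv
    have := ODE_solution_unique_univ (v := fun t y => B t y) (s := fun _ => univ) (t₀ := t)
      (f := fun t => Φ t v) (g := fun _ => 0) hLip
      (fun t => ⟨hasDerivAt_clm_apply_of_fundamental hΦ v t, trivial⟩)
      (fun t => ⟨by simpa using hasDerivAt_const t (0 : E), trivial⟩) hv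
    simpa [hΦ0] using congrFun this 0
  have hunit : IsUnit (Φ t : E →ₗ[ℝ] E) := by
    rw [LinearMap.isUnit_iff_ker_eq_bot]
    exact LinearMap.ker_eq_bot.2 hinj
  let e := ContinuousLinearEquiv.ofBijective (Φ t) (LinearMap.ker_eq_bot.2 hinj)
    (LinearMap.range_eq_top.2 (LinearMap.injective_iff_surjective (f := (Φ t : E →ₗ[ℝ] E)).1 hinj))
  have he : (e : E →L[ℝ] E) = Φ t := by ext v; rfl
  exact ⟨⟨e, e.symm, by ext v; simp, by ext v; simp⟩, he⟩

/-- Uniqueness, on `[0, 1]`, of solutions of the inhomogeneous linear equation `v' = B v + k`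
with bounded `B`. -/
theorem linearODE_unique_on_unitInterval {B : ℝ → E →L[ℝ] E} {L : ℝ} (hB : ∀ t, ‖B t‖ ≤ L)
    {k v w : ℝ → E} (hv : ContinuousOn v (Icc 0 1)) (hw : ContinuousOn w (Icc 0 1))
    (hv' : ∀ t ∈ Ico (0 : ℝ) 1, HasDerivWithinAt v (B t (v t) + k t) (Ici t) t)
    (hw' : ∀ t ∈ Ico (0 : ℝ) 1, HasDerivWithinAt w (B t (w t) + k t) (Ici t) t)
    (h0 : v 0 = w 0) : EqOn v w (Icc 0 1) := by
  refine ODE_solution_unique (v := fun t y => B t y + k t) (K := L.toNNReal) (fun t => ?_)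
    hv hv' hw hw' h0
  refine LipschitzWith.of_dist_le_mul fun y z => ?_
  rw [dist_add_right, dist_eq_norm, ← map_sub, dist_eq_norm]
  refine ((B t).le_opNorm _).trans ?_
  gcongr
  exact (hB t).trans (Real.le_coe_toNNReal L)

end LinearODE

/-! ### The period map on curves and its linearization -/

section PeriodMap

variable {E : Type*} [NormedAddCommGroup E]

/-- The constant extension to the line of a curve parametrized by the unit interval. -/
noncomputable def extendCurve (u : C(unitInterval, E)) : ℝ → E := IccExtend zero_le_one u

theorem continuous_extendCurve (u : C(unitInterval, E)) : Continuous (extendCurve u) :=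
  u.continuous.Icc_extend'

theorem extendCurve_coe (u : C(unitInterval, E)) (t : unitInterval) : extendCurve u t = u t :=
  IccExtend_val _ _ _

theorem extendCurve_of_mem (u : C(unitInterval, E)) {t : ℝ} (ht : t ∈ Icc (0 : ℝ) 1) :
    extendCurve u t = u ⟨t, ht⟩ := IccExtend_of_mem _ _ ht

theorem norm_extendCurve_le (u : C(unitInterval, E)) (t : ℝ) : ‖extendCurve u t‖ ≤ ‖u‖ :=
  u.norm_coe_le_norm _

theorem integral_norm_extendCurve_le (u : C(unitInterval, E)) :
    ∫ r in (0 : ℝ)..1, ‖extendCurve u r‖ ≤ ‖u‖ := by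
  have hc : Continuous fun r => ‖extendCurve u r‖ := (continuous_extendCurve u).norm
  have := intervalIntegral.integral_mono_on (μ := volume) zero_le_one
    (hc.intervalIntegrable 0 1) (intervalIntegrable_const (c := ‖u‖))
    (fun r _ => norm_extendCurve_le u r)
  simpa using this

/-- Restriction of a continuous curve to the unit interval. -/
noncomputable def restrictCurve {F : Type*} [TopologicalSpace F] (u : ℝ → F) (hu : Continuous u) :
    C(unitInterval, F) := ⟨fun t => u t, hu.comp continuous_subtype_val⟩

theorem extendCurve_restrictCurve {u : ℝ → E} (hu : Continuous u) {t : ℝ}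
    (ht : t ∈ Icc (0 : ℝ) 1) : extendCurve (restrictCurve u hu) t = u t :=
  extendCurve_of_mem _ ht

variable [NormedSpace ℝ E]

theorem norm_integral_extendCurve_le (u : C(unitInterval, E)) {t : ℝ} (ht : t ∈ Icc (0 : ℝ) 1) :
    ‖∫ r in (0 : ℝ)..t, extendCurve u r‖ ≤ ∫ r in (0 : ℝ)..1, ‖extendCurve u r‖ := by
  have hc : Continuous fun r => ‖extendCurve u r‖ := (continuous_extendCurve u).norm
  refine (intervalIntegral.norm_integral_le_integral_norm ht.1).trans ?_
  exact intervalIntegral.integral_mono_interval le_rfl ht.1 ht.2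
    (Eventually.of_forall fun _ => norm_nonneg _) (hc.intervalIntegrable _ _)

/-- The primitive, vanishing at `0`, of a curve parametrized by the unit interval. -/
noncomputable def primitive : C(unitInterval, E) →L[ℝ] C(unitInterval, E) :=
  LinearMap.mkContinuous
    { toFun := fun u => ⟨fun t => ∫ r in (0 : ℝ)..t, extendCurve u r,
        (intervalIntegral.continuous_primitive
          (fun a b => (continuous_extendCurve u).intervalIntegrable a b) 0).comp
          continuous_subtype_val⟩
      map_add' := fun u v => by
        ext t
        exact intervalIntegral.integral_add ((continuous_extendCurve u).intervalIntegrable _ _)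
          ((continuous_extendCurve v).intervalIntegrable _ _)
      map_smul' := fun c u => by
        ext t
        exact intervalIntegral.integral_smul c (extendCurve u) }
    1 (fun u => by
      rw [one_mul, ContinuousMap.norm_le _ (norm_nonneg _)]
      exact fun t => (norm_integral_extendCurve_le u t.2).trans (integral_norm_extendCurve_le u))

theorem primitive_apply (u : C(unitInterval, E)) (t : unitInterval) :
    primitive u t = ∫ r in (0 : ℝ)..t, extendCurve u r := rfl

/-- This L¹ bound, rather than the cruder sup bound, is what lets a tall but narrow perturbation
move the orbit only slightly. -/
theorem norm_primitive_le_integral (u : C(unitInterval, E)) :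
    ‖primitive u‖ ≤ ∫ r in (0 : ℝ)..1, ‖extendCurve u r‖ :=
  (ContinuousMap.norm_le _ (intervalIntegral.integral_nonneg zero_le_one
    fun _ _ => norm_nonneg _)).2 fun t => norm_integral_extendCurve_le u t.2

theorem norm_primitive_le (u : C(unitInterval, E)) : ‖primitive u‖ ≤ ‖u‖ :=
  (norm_primitive_le_integral u).trans (integral_norm_extendCurve_le u)

/-- The pointwise action of a curve of operators on curves. -/
noncomputable def operatorAction (β : C(unitInterval, E →L[ℝ] E)) :
    C(unitInterval, E) →L[ℝ] C(unitInterval, E) :=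
  LinearMap.mkContinuous
    { toFun := fun u => ⟨fun t => β t (u t), β.continuous.clm_apply u.continuous⟩
      map_add' := fun u v => by ext t; simp
      map_smul' := fun c u => by ext t; simp }
    ‖β‖ (fun u => by
      rw [ContinuousMap.norm_le _ (by positivity)]
      exact fun t => ((β t).le_opNorm _).trans
        (mul_le_mul (β.norm_coe_le_norm t) (u.norm_coe_le_norm t) (norm_nonneg _)
          (norm_nonneg β)))

theorem operatorAction_apply (β : C(unitInterval, E →L[ℝ] E)) (u : C(unitInterval, E))
    (t : unitInterval) : operatorAction β u t = β t (u t) := rfl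

/-- The inclusion of the constant curves. -/
noncomputable def constantCurve : E →L[ℝ] C(unitInterval, E) :=
  LinearMap.mkContinuous
    { toFun := fun v => ContinuousMap.const _ v
      map_add' := fun u v => by ext t; simp
      map_smul' := fun c u => by ext t; simp }
    1 (fun u => by
      rw [one_mul, ContinuousMap.norm_le _ (norm_nonneg _)]
      exact fun t => le_rfl)

theorem constantCurve_apply (v : E) (t : unitInterval) : constantCurve v t = v := rfl

/-- The zeros `(u, S)` of this map are the periodic solutions `t ↦ u (t / S)` of `ẋ = g(x)` that
satisfy the phase condition `l (u 0) = a`. -/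
noncomputable def periodMap (l : E →L[ℝ] ℝ) (a : ℝ) (g : C(E, E)) (w : C(unitInterval, E) × ℝ) :
    C(unitInterval, E) × ℝ :=
  (w.1 - constantCurve (w.1 1) - w.2 • primitive (g.comp w.1), l (w.1 0) - a)

/-- The linearization of `periodMap`. -/
noncomputable def linearPeriodMap (l : E →L[ℝ] ℝ) (β : C(unitInterval, E →L[ℝ] E))
    (ψ : C(unitInterval, E)) : C(unitInterval, E) × ℝ →L[ℝ] C(unitInterval, E) × ℝ :=
  ((ContinuousLinearMap.id ℝ _ - constantCurve.comp (ContinuousMap.evalCLM ℝ 1) -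
      primitive.comp (operatorAction β)).comp (ContinuousLinearMap.fst ℝ _ _) -
    (ContinuousLinearMap.toSpanSingleton ℝ (primitive ψ)).comp
      (ContinuousLinearMap.snd ℝ _ _)).prod
    ((l.comp (ContinuousMap.evalCLM ℝ 0)).comp (ContinuousLinearMap.fst ℝ _ _))

theorem linearPeriodMap_apply (l : E →L[ℝ] ℝ) (β : C(unitInterval, E →L[ℝ] E))
    (ψ : C(unitInterval, E)) (w : C(unitInterval, E) × ℝ) :
    linearPeriodMap l β ψ w =
      (w.1 - constantCurve (w.1 1) - primitive (operatorAction β w.1) - w.2 • primitive ψ,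
        l (w.1 0)) := by
  ext <;> simp [linearPeriodMap]

end PeriodMap

/-! ### Nondegeneracy of the linearized period map -/

section Bijective

variable {E : Type*} [NormedAddCommGroup E] [NormedSpace ℝ E] [FiniteDimensional ℝ E]

/-- Variation of constants solves the integral equation explicitly in terms of an initial value and
σ. What remains is the closing condition at time 1 together with the phase condition, which is a
system for the bordered operator of the monodromy. -/
theorem bijective_linearPeriodMap {B Φ : ℝ → E →L[ℝ] E} {L : ℝ} (hBc : Continuous B)
    (hB : ∀ t, ‖B t‖ ≤ L) (hΦ0 : Φ 0 = ContinuousLinearMap.id ℝ E)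
    (hΦ : ∀ t, HasDerivAt Φ ((B t).comp (Φ t)) t)
    (hroot : (Φ 1 : E →ₗ[ℝ] E).charpoly.rootMultiplicity 1 = 1)
    {ψ : ℝ → E} (hψ : ∀ t, HasDerivAt ψ (B t (ψ t)) t) (hψ1 : ψ 1 = ψ 0) (hψc : Continuous ψ)
    {l : E →L[ℝ] ℝ} (hl : l (ψ 0) = 1) :
    Function.Bijective (linearPeriodMap l (restrictCurve B hBc) (restrictCurve ψ hψc)) := by
  have heig : Φ 1 (ψ 0) = ψ 0 := by rw [← eq_fundamental_apply hB hΦ0 hΦ hψ 1, hψ1]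
  have hbord := bijective_bordered_of_rootMultiplicity_eq_one (Φ 1 : E →ₗ[ℝ] E) (ψ 0)
    (l : E →ₗ[ℝ] ℝ) hroot heig hl
  have hΦc : Continuous Φ := continuous_iff_continuousAt.2 fun t => (hΦ t).continuousAt
  -- The forcing σ ψ is resonant, ψ being a solution of the homogeneous equation, and contributes
  -- the secular term σ t ψ.
  have hexpl : ∀ (v₀ : E) (σ : ℝ) (k : ℝ → E) (q : ℝ → E),
      (∀ t, HasDerivAt q (Ring.inverse (Φ t) (k t)) t) → ∀ t,
      HasDerivAt (fun t => Φ t (v₀ + q t) + (σ * t) • ψ t)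
        (B t (Φ t (v₀ + q t) + (σ * t) • ψ t) + (k t + σ • ψ t)) t := by
    intro v₀ σ k q hq t
    have h1 := (hΦ t).clm_apply ((hq t).const_add v₀)
    have h2 := (((hasDerivAt_id t).const_mul σ)).smul (hψ t)
    refine (h1.add h2).congr_deriv ?_
    have : Φ t (Ring.inverse (Φ t) (k t)) = k t := by
      have := Ring.mul_inverse_cancel (Φ t) (isUnit_fundamental hB hΦ0 hΦ t)
      exact congrArg (fun M : E →L[ℝ] E => M (k t)) this
    simp only [this, id, map_add, map_smul, ContinuousLinearMap.comp_apply, mul_one]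
    abel
  constructor
  · rw [injective_iff_map_eq_zero]
    rintro ⟨v, σ⟩ hv
    rw [linearPeriodMap_apply, Prod.mk_eq_zero] at hv
    obtain ⟨hv1, hv2⟩ := hv
    dsimp only at hv1 hv2
    -- `W` is the right-hand side of the integral equation: it agrees with `v` on [0, 1] and is
    -- differentiable there.
    set W : ℝ → E := fun t => v 1 + ((∫ r in (0 : ℝ)..t,
      extendCurve (operatorAction (restrictCurve B hBc) v) r) +
        σ • ∫ r in (0 : ℝ)..t, extendCurve (restrictCurve ψ hψc) r) with hW
    have hWv : ∀ t (ht : t ∈ Icc (0 : ℝ) 1), W t = v ⟨t, ht⟩ := fun t ht => by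
      have := DFunLike.congr_fun hv1 (⟨t, ht⟩ : unitInterval)
      simp only [ContinuousMap.sub_apply, constantCurve_apply, primitive_apply,
        ContinuousMap.smul_apply, ContinuousMap.zero_apply] at this
      rw [hW]
      dsimp only
      rw [sub_sub, sub_sub, sub_eq_zero] at this
      rw [this]
    have hWd : ∀ t ∈ Icc (0 : ℝ) 1, HasDerivAt W (B t (W t) + ((0 : ℝ → E) t + σ • ψ t)) t := by
      intro t ht
      have h1 := (continuous_extendCurve
        (operatorAction (restrictCurve B hBc) v)).integral_hasStrictDerivAt 0 t
      have h2 := (continuous_extendCurve (restrictCurve ψ hψc)).integral_hasStrictDerivAt 0 t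
      refine ((h1.hasDerivAt.add (h2.hasDerivAt.const_smul σ)).const_add (v 1)).congr_deriv ?_
      rw [extendCurve_restrictCurve _ ht, extendCurve_of_mem _ ht, operatorAction_apply,
        hWv t ht, Pi.zero_apply, zero_add]
      rfl
    have hX := hexpl (v 1) σ 0 0 (fun t => by simp)
    have hEq := linearODE_unique_on_unitInterval hB (k := fun t => (0 : ℝ → E) t + σ • ψ t)
      (fun t ht => (hWd t ht).continuousAt.continuousWithinAt)
      (fun t ht => (hX t).continuousAt.continuousWithinAt)
      (fun t ht => (hWd t ⟨ht.1, ht.2.le⟩).hasDerivWithinAt)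
      (fun t ht => (hX t).hasDerivWithinAt) (by simp [hW, hΦ0])
    have hz : ((v 1, σ) : E × ℝ) = 0 := by
      apply hbord.1
      have h1 := hEq (right_mem_Icc.2 zero_le_one)
      have h0 := hWv 0 (left_mem_Icc.2 zero_le_one)
      rw [hWv 1 (right_mem_Icc.2 zero_le_one)] at h1
      have e1 : (⟨1, right_mem_Icc.2 zero_le_one⟩ : unitInterval) = 1 := rfl
      have e0 : (⟨0, left_mem_Icc.2 zero_le_one⟩ : unitInterval) = 0 := rfl
      rw [e1] at h1
      rw [e0] at h0
      have h01 : v 0 = v 1 := by rw [← h0]; simp [hW]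
      rw [h01] at hv2
      simp only [Pi.zero_apply, add_zero, mul_one, hψ1] at h1
      simp only [ContinuousLinearMap.coe_coe, hv2, Prod.fst_zero, Prod.snd_zero, map_zero,
        sub_zero, zero_smul, add_zero, Prod.mk.injEq, and_true]
      rw [sub_add_eq_add_sub, ← h1, sub_self]
    have hv10 : v 1 = 0 := congrArg Prod.fst hz
    have hσ : σ = 0 := congrArg Prod.snd hz
    have : v = 0 := by
      ext t
      have := hEq t.2
      rw [hWv t t.2] at this
      simpa [hv10, hσ] using this
    rw [this, hσ]
    rfl
  · rintro ⟨h, c⟩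
    have hinvc : Continuous fun t => Ring.inverse (Φ t) := by
      refine continuous_iff_continuousAt.2 fun t => ?_
      obtain ⟨u, hu⟩ := isUnit_fundamental hB hΦ0 hΦ t
      refine ContinuousAt.comp (g := Ring.inverse) ?_ hΦc.continuousAt
      rw [← hu]
      exact NormedRing.inverse_continuousAt u
    -- The preimage is sought as w + h. Then w solves w' = B w + B h + σ ψ, and the equation for the
    -- curve reduces to w 1 + h 1 = w 0.
    set k : ℝ → E := fun t => B t (extendCurve h t) with hk
    have hkc : Continuous k := hBc.clm_apply (continuous_extendCurve h)
    set q : ℝ → E := fun t => ∫ r in (0 : ℝ)..t, Ring.inverse (Φ r) (k r) with hq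
    have hqd : ∀ t, HasDerivAt q (Ring.inverse (Φ t) (k t)) t := fun t =>
      ((hinvc.clm_apply hkc).integral_hasStrictDerivAt 0 t).hasDerivAt
    obtain ⟨⟨v₀, σ⟩, hvσ⟩ := hbord.2 (-(h 1) - Φ 1 (q 1), c - l (h 0))
    rw [Prod.mk.injEq] at hvσ
    obtain ⟨hb1, hb2⟩ := hvσ
    simp only [ContinuousLinearMap.coe_coe] at hb1 hb2
    have hX := hexpl v₀ σ k q hqd
    set w : ℝ → E := fun t => Φ t (v₀ + q t) + (σ * t) • ψ t with hw
    have hwc : Continuous w := continuous_iff_continuousAt.2 fun t => (hX t).continuousAt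
    have hw0 : w 0 = v₀ := by simp [hw, hq, hΦ0]
    have hw1 : w 1 + h 1 = v₀ := by
      simp only [hw, mul_one, hψ1, map_add]
      have : Φ 1 v₀ + σ • ψ 0 = v₀ + (-(h 1) - Φ 1 (q 1)) := by rw [← hb1]; abel
      calc Φ 1 v₀ + Φ 1 (q 1) + σ • ψ 0 + h 1
          = (Φ 1 v₀ + σ • ψ 0) + Φ 1 (q 1) + h 1 := by abel
        _ = v₀ := by rw [this]; abel
    refine ⟨(restrictCurve w hwc + h, σ), ?_⟩
    rw [linearPeriodMap_apply]
    refine Prod.ext ?_ ?_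
    · ext t
      have hr : ∀ r ∈ uIcc (0 : ℝ) t,
          extendCurve (operatorAction (restrictCurve B hBc) (restrictCurve w hwc + h)) r +
            σ • extendCurve (restrictCurve ψ hψc) r = B r (w r) + (k r + σ • ψ r) := by
        intro r hr
        rw [uIcc_of_le t.2.1] at hr
        have hr' : r ∈ Icc (0 : ℝ) 1 := ⟨hr.1, hr.2.trans t.2.2⟩
        rw [extendCurve_restrictCurve _ hr', extendCurve_of_mem _ hr', operatorAction_apply, hk]
        dsimp only
        rw [extendCurve_of_mem h hr', ContinuousMap.add_apply, map_add, add_assoc]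
        rfl
      have hint : (∫ r in (0 : ℝ)..t,
          extendCurve (operatorAction (restrictCurve B hBc) (restrictCurve w hwc + h)) r) +
            σ • ∫ r in (0 : ℝ)..t, extendCurve (restrictCurve ψ hψc) r = w t - w 0 := by
        rw [← intervalIntegral.integral_smul]
        refine (intervalIntegral.integral_add
          ((continuous_extendCurve _).intervalIntegrable _ _)
          (((continuous_extendCurve _).const_smul σ).intervalIntegrable _ _)).symm.trans ?_
        refine (intervalIntegral.integral_congr hr).trans ?_
        refine intervalIntegral.integral_eq_sub_of_hasDerivAt (fun r _ => hX r) ?_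
        exact ((hBc.clm_apply hwc).add (hkc.add (hψc.const_smul σ))).intervalIntegrable _ _
      simp only [ContinuousMap.sub_apply, constantCurve_apply, primitive_apply,
        ContinuousMap.smul_apply]
      rw [sub_sub, hint, ContinuousMap.add_apply, ContinuousMap.add_apply]
      have e1 : restrictCurve w hwc 1 = w 1 := rfl
      have et : restrictCurve w hwc t = w t := rfl
      rw [e1, et, hw1, hw0]
      abel
    · have e0 : restrictCurve w hwc 0 = w 0 := rfl
      simp only [ContinuousMap.add_apply, e0, hw0, map_add, hb2]
      abel

end Bijective

/-! ### Persistence of hyperbolic periodic orbits -/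

section Persistence

/-- A `C¹` map is uniformly strictly differentiable along a compact set. -/
theorem IsCompact.exists_uniform_strict_fderiv {E F : Type*} [NormedAddCommGroup E]
    [NormedSpace ℝ E] [NormedAddCommGroup F] [NormedSpace ℝ F] {f : E → F} (hf : ContDiff ℝ 1 f)
    {s : Set E} (hs : IsCompact s) {η : ℝ} (hη : 0 < η) :
    ∃ ρ > 0, ∀ z ∈ s, ∀ a ∈ closedBall z ρ, ∀ b ∈ closedBall z ρ,
      ‖f a - f b - fderiv ℝ f z (a - b)‖ ≤ η * ‖a - b‖ := by
  have hc : Continuous (fderiv ℝ f) := hf.continuous_fderiv one_ne_zero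
  -- Only one of the two points compared has to lie in `s`, so no compact neighbourhood is needed.
  have h := hs.uniformContinuousAt_of_continuousAt (fderiv ℝ f) (fun z _ => hc.continuousAt)
    (dist_mem_uniformity hη)
  obtain ⟨ρ, hρ, h⟩ := Metric.mem_uniformity_dist.1 h
  refine ⟨ρ / 2, by positivity, fun z hz a ha b hb => ?_⟩
  refine (convex_closedBall z (ρ / 2)).norm_image_sub_le_of_norm_fderiv_le'
    (fun y _ => (hf.differentiable one_ne_zero).differentiableAt) (fun y hy => ?_) hb ha
  have hzy : dist z y < ρ := by
    rw [mem_closedBall, dist_comm] at hy; linarith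
  have := h hzy hz
  simp only [mem_ofPred_eq] at this
  rw [← dist_eq_norm, dist_comm]
  exact this.le

variable {E : Type*} [NormedAddCommGroup E] [NormedSpace ℝ E]

theorem IsPeriodicOrbit.continuous {g : E → E} {x : ℝ → E} {T : ℝ} (h : IsPeriodicOrbit g x T) :
    Continuous x := continuous_iff_continuousAt.2 fun t => (h.solves t).continuousAt

theorem IsPeriodicOrbit.hasDerivAt_rescaled {g : E → E} {x : ℝ → E} {T : ℝ}
    (h : IsPeriodicOrbit g x T) (τ t : ℝ) :
    HasDerivAt (fun t => x (τ + T * t)) (T • g (x (τ + T * t))) t := by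
  have h1 : HasDerivAt (fun t => τ + T * t) T t := by
    simpa using ((hasDerivAt_id t).const_mul T).const_add τ
  exact (h.solves (τ + T * t)).scomp t h1

theorem IsPeriodicOrbit.continuous_rescaled {g : E → E} {x : ℝ → E} {T : ℝ}
    (h : IsPeriodicOrbit g x T) : Continuous fun t => x (T * t) :=
  h.continuous.comp (continuous_const.mul continuous_id)

/-- A periodic orbit, run through once in unit time. -/
noncomputable def IsPeriodicOrbit.unitCurve {g : E → E} {x : ℝ → E} {T : ℝ}
    (h : IsPeriodicOrbit g x T) : C(unitInterval, E) :=
  restrictCurve (fun t => x (T * t)) h.continuous_rescaled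

theorem IsPeriodicOrbit.unitCurve_apply {g : E → E} {x : ℝ → E} {T : ℝ}
    (h : IsPeriodicOrbit g x T) (t : unitInterval) : h.unitCurve t = x (T * t) := rfl

/-- The period map is affine in the vector field, so the perturbation enters only through its
primitive along the curve. -/
theorem periodMap_add_sub (l : E →L[ℝ] ℝ) (a : ℝ) (g p : C(E, E)) (w : C(unitInterval, E) × ℝ) :
    periodMap l a (g + p) w - periodMap l a g w = (-(w.2 • primitive (p.comp w.1)), 0) := by
  have hadd : (g + p).comp w.1 = g.comp w.1 + p.comp w.1 := rfl
  refine Prod.ext ?_ ?_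
  · simp only [periodMap, hadd, map_add, smul_add, Prod.fst_sub]
    abel
  · simp [periodMap]

theorem IsPeriodicOrbit.periodMap_eq_zero [CompleteSpace E] {g : C(E, E)} {y : ℝ → E} {S : ℝ}
    (h : IsPeriodicOrbit g y S) {u : C(unitInterval, E)} {τ : ℝ} (hu : ∀ t, u t = y (τ + S * t))
    {l : E →L[ℝ] ℝ} {a : ℝ} (ha : l (u 0) = a) : periodMap l a g (u, S) = 0 := by
  have hd := h.hasDerivAt_rescaled τ
  have hc : Continuous fun t => y (τ + S * t) :=
    continuous_iff_continuousAt.2 fun t => (hd t).continuousAt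
  refine Prod.ext ?_ (by simp [periodMap, ha])
  ext t
  have hint : S • ∫ r in (0 : ℝ)..t, extendCurve (g.comp u) r = y (τ + S * t) - y τ := by
    rw [← intervalIntegral.integral_smul]
    have : ∀ r ∈ uIcc (0 : ℝ) t, S • extendCurve (g.comp u) r = S • g (y (τ + S * r)) := by
      intro r hr
      rw [uIcc_of_le t.2.1] at hr
      rw [extendCurve_of_mem _ ⟨hr.1, hr.2.trans t.2.2⟩, ContinuousMap.comp_apply, hu]
    rw [intervalIntegral.integral_congr this]
    have := intervalIntegral.integral_eq_sub_of_hasDerivAt (fun r _ => hd r)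
      (((g.continuous.comp hc).const_smul S).intervalIntegrable 0 t)
    simpa using this
  have h1 : u 1 = y τ := by rw [hu]; simp [h.periodic]
  simp only [periodMap, ContinuousMap.sub_apply, ContinuousMap.smul_apply, constantCurve_apply,
    primitive_apply, Prod.fst_zero, ContinuousMap.zero_apply, h1, hint, hu]
  abel

/-- The error of the linear approximation of `periodMap` at an orbit, in terms of pointwise
estimates along the orbit. -/
theorem norm_periodMap_sub_sub_le {f : E → E} (hf : Continuous f) {l : E →L[ℝ] ℝ} {a : ℝ}
    {β : C(unitInterval, E →L[ℝ] E)} {v : C(unitInterval, E)} {D : E → E →L[ℝ] E} {T L m ρ : ℝ}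
    (hT : 0 < T) (hβ : ∀ t, β t = T • D (v t)) (hL : ∀ t, ‖D (v t)‖ ≤ L) (hm : m ≤ 1)
    (hm0 : 0 ≤ m) (hρ : ρ ≤ m)
    (hstrict : ∀ t, ∀ y ∈ closedBall (v t) ρ, ∀ z ∈ closedBall (v t) ρ,
      ‖f y - f z - D (v t) (y - z)‖ ≤ m * ‖y - z‖)
    {p : C(E, E)} (hp : ∀ z, ‖p z‖ ≤ m) (hp' : LipschitzWith m.toNNReal p)
    {w₁ w₂ : C(unitInterval, E) × ℝ} (h₁ : w₁ ∈ closedBall (v, T) ρ)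
    (h₂ : w₂ ∈ closedBall (v, T) ρ) :
    ‖periodMap l a (⟨f, hf⟩ + p) w₁ - periodMap l a (⟨f, hf⟩ + p) w₂ -
      linearPeriodMap l β ((⟨f, hf⟩ : C(E, E)).comp v) (w₁ - w₂)‖ ≤
      ((2 * L + 2 * T + 4) * m) * ‖w₁ - w₂‖ := by
  obtain ⟨u₁, S₁⟩ := w₁
  obtain ⟨u₂, S₂⟩ := w₂
  set g : C(E, E) := ⟨f, hf⟩ + p with hg
  set ψ : C(unitInterval, E) := (⟨f, hf⟩ : C(E, E)).comp v with hψ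
  set d := ‖((u₁, S₁) : C(unitInterval, E) × ℝ) - (u₂, S₂)‖ with hd
  have hL0 : 0 ≤ L := (norm_nonneg _).trans (hL 0)
  have hd0 : 0 ≤ d := norm_nonneg _
  have hu : ∀ t, ‖u₁ t - u₂ t‖ ≤ d := fun t =>
    ((u₁ - u₂).norm_coe_le_norm t).trans
      (norm_fst_le (((u₁, S₁) : C(unitInterval, E) × ℝ) - (u₂, S₂)))
  have hS : |S₁ - S₂| ≤ d := norm_snd_le (((u₁, S₁) : C(unitInterval, E) × ℝ) - (u₂, S₂))
  rw [← closedBall_prod_same, mem_prod, mem_closedBall, mem_closedBall, Real.dist_eq] at h₁ h₂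
  obtain ⟨hu₁, hS₁⟩ := h₁
  obtain ⟨hu₂, hS₂⟩ := h₂
  dsimp only at hu₁ hS₁ hu₂ hS₂
  have hρ0 : 0 ≤ ρ := dist_nonneg.trans hu₁
  have hb₁ : ∀ t, u₁ t ∈ closedBall (v t) ρ := fun t =>
    mem_closedBall.2 ((ContinuousMap.dist_apply_le_dist t).trans hu₁)
  have hb₂ : ∀ t, u₂ t ∈ closedBall (v t) ρ := fun t =>
    mem_closedBall.2 ((ContinuousMap.dist_apply_le_dist t).trans hu₂)
  -- The boundary and phase terms are linear and cancel, so the whole error is minus the primitive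
  -- of `R`.
  set R : C(unitInterval, E) := (S₁ - S₂) • (g.comp u₁ - ψ) + S₂ • (g.comp u₁ - g.comp u₂) -
    operatorAction β (u₁ - u₂) with hR
  have hdiff : periodMap l a g (u₁, S₁) - periodMap l a g (u₂, S₂) -
      linearPeriodMap l β ψ ((u₁, S₁) - (u₂, S₂)) = (-primitive R, 0) := by
    rw [linearPeriodMap_apply, periodMap, periodMap, hR]
    refine Prod.ext ?_ ?_
    · ext t
      simp only [Prod.fst_sub, Prod.snd_sub, map_sub, map_add, map_smul, ContinuousMap.sub_apply,
        ContinuousMap.neg_apply, ContinuousMap.add_apply, ContinuousMap.smul_apply,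
        constantCurve_apply]
      module
    · simp
  have hRt : ∀ t, ‖R t‖ ≤ ((2 * L + 2 * T + 4) * m) * d := by
    intro t
    have hpL : ‖p (u₁ t) - p (u₂ t)‖ ≤ m * d := by
      have := hp'.dist_le_mul (u₁ t) (u₂ t)
      rw [dist_eq_norm, dist_eq_norm, Real.coe_toNNReal _ hm0] at this
      exact this.trans (by gcongr; exact hu t)
    have h1 : ‖f (u₁ t) - f (v t)‖ ≤ (L + 1) * m := by
      have e1 := hstrict t (u₁ t) (hb₁ t) (v t) (mem_closedBall_self hρ0)
      have e2 := (D (v t)).le_opNorm (u₁ t - v t)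
      have e3 : ‖u₁ t - v t‖ ≤ m := by
        rw [← dist_eq_norm]; exact (mem_closedBall.1 (hb₁ t)).trans hρ
      have e4 := norm_sub_norm_le (f (u₁ t) - f (v t)) (D (v t) (u₁ t - v t))
      have e5 : ‖D (v t)‖ * ‖u₁ t - v t‖ ≤ L * m := by
        gcongr
        exact hL t
      have e6 : m * ‖u₁ t - v t‖ ≤ 1 * m := by gcongr
      linarith
    have h2 : ‖f (u₁ t) - f (u₂ t) - D (v t) (u₁ t - u₂ t)‖ ≤ m * d :=
      (hstrict t _ (hb₁ t) _ (hb₂ t)).trans (by gcongr; exact hu t)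
    have h3 : ‖D (v t) (u₁ t - u₂ t)‖ ≤ L * d :=
      ((D (v t)).le_opNorm _).trans (by gcongr; exacts [hL t, hu t])
    have hS₂' : |S₂| ≤ T + 1 := by
      have := abs_le.1 hS₂
      rw [abs_le]; constructor <;> linarith [this.1, this.2]
    -- The five terms contribute (L + 1) m, m, (T + 1) m, (T + 1) m and L m times `d`; this is the
    -- constant 2 L + 2 T + 4.
    have hRt : R t = (S₁ - S₂) • (f (u₁ t) - f (v t)) + (S₁ - S₂) • p (u₁ t) +
        S₂ • (f (u₁ t) - f (u₂ t) - D (v t) (u₁ t - u₂ t)) + S₂ • (p (u₁ t) - p (u₂ t)) +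
        (S₂ - T) • D (v t) (u₁ t - u₂ t) := by
      simp only [hR, hg, hψ, ContinuousMap.sub_apply, ContinuousMap.add_apply,
        ContinuousMap.smul_apply, ContinuousMap.comp_apply, operatorAction_apply, hβ,
        ContinuousMap.coe_mk, smul_apply]
      module
    rw [hRt]
    calc _ ≤ ‖(S₁ - S₂) • (f (u₁ t) - f (v t))‖ + ‖(S₁ - S₂) • p (u₁ t)‖ +
        ‖S₂ • (f (u₁ t) - f (u₂ t) - D (v t) (u₁ t - u₂ t))‖ + ‖S₂ • (p (u₁ t) - p (u₂ t))‖ +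
        ‖(S₂ - T) • D (v t) (u₁ t - u₂ t)‖ :=
          (norm_add_le _ _).trans (add_le_add (norm_add₄_le) le_rfl)
      _ ≤ d * ((L + 1) * m) + d * m + (T + 1) * (m * d) + (T + 1) * (m * d) + m * (L * d) := by
          simp only [norm_smul, Real.norm_eq_abs]
          gcongr
          · exact hp _
          · exact hS₂.trans hρ
      _ = _ := by ring
  rw [hdiff, Prod.norm_mk, norm_neg, norm_zero, max_eq_left (norm_nonneg _)]
  exact (norm_primitive_le R).trans ((ContinuousMap.norm_le _ (by positivity)).2 hRt)

/-- The orbit is an exact zero for `f`, so only the primitive of `p` along it is left. -/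
theorem norm_periodMap_orbit_le [CompleteSpace E] {f : E → E} (hf : Continuous f) {x : ℝ → E} {T : ℝ}
    (h : IsPeriodicOrbit f x T) (l : E →L[ℝ] ℝ) (p : C(E, E)) {ε : ℝ} (hp : ∀ z, ‖p z‖ ≤ ε) :
    ‖periodMap l (l (x 0)) (⟨f, hf⟩ + p) (h.unitCurve, T)‖ ≤ T * ε := by
  have hε : 0 ≤ ε := (norm_nonneg _).trans (hp 0)
  have hT := h.pos
  have hz : periodMap l (l (x 0)) (⟨f, hf⟩ + p) (h.unitCurve, T) =
      (-(T • primitive (p.comp h.unitCurve)), 0) := by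
    have h0 := h.periodMap_eq_zero (g := ⟨f, hf⟩) (u := h.unitCurve) (τ := 0) (l := l)
      (a := l (x 0)) (fun t => by rw [h.unitCurve_apply, zero_add]) (by simp [h.unitCurve_apply])
    rw [← sub_zero (periodMap l (l (x 0)) (⟨f, hf⟩ + p) (h.unitCurve, T)), ← h0]
    exact periodMap_add_sub l _ _ _ _
  rw [hz, Prod.norm_mk, norm_neg, norm_zero, max_eq_left (norm_nonneg _), norm_smul,
    Real.norm_eq_abs, abs_of_pos hT]
  gcongr
  exact (norm_primitive_le _).trans ((ContinuousMap.norm_le _ hε).2 fun t => hp _)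

variable [FiniteDimensional ℝ E]

/-- The linearization along a hyperbolic orbit is an isomorphism for a suitable phase condition. -/
theorem IsHyperbolicOrbit.exists_bijective {f : E → E} (hf : ContDiff ℝ 1 f) {x : ℝ → E} {T : ℝ}
    (h : IsHyperbolicOrbit f x T) :
    ∃ l : E →L[ℝ] ℝ, l (f (x 0)) = 1 ∧ ∃ β : C(unitInterval, E →L[ℝ] E),
      (∀ t, β t = T • fderiv ℝ f (h.orbit.unitCurve t)) ∧
      Function.Bijective (linearPeriodMap l β
        ((⟨f, hf.continuous⟩ : C(E, E)).comp h.orbit.unitCurve)) := by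
  obtain ⟨Φ, hΦ0, hΦ, hroot, -⟩ := h.floquet
  have hfc : Continuous (fderiv ℝ f) := hf.continuous_fderiv one_ne_zero
  have hxc := h.orbit.continuous_rescaled
  set B : ℝ → E →L[ℝ] E := fun t => T • fderiv ℝ f (x (T * t)) with hB
  have hBc : Continuous B := (hfc.comp hxc).const_smul T
  have hBp : Function.Periodic B 1 := fun t => by
    simp only [hB, mul_add, mul_one, h.orbit.periodic]
  obtain ⟨L, hL⟩ : ∃ L, ∀ t, ‖B t‖ ≤ L := by
    obtain ⟨L, hL⟩ := (hBp.isBounded_of_continuous one_ne_zero hBc).exists_norm_le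
    exact ⟨L, fun t => hL _ ⟨t, rfl⟩⟩
  -- The velocity along the orbit solves the variational equation; it is the eigenvector for the
  -- multiplier 1.
  set ψ : ℝ → E := fun t => f (x (T * t)) with hψdef
  have hψ : ∀ t, HasDerivAt ψ (B t (ψ t)) t := fun t => by
    have h1 := h.orbit.hasDerivAt_rescaled 0 t
    simp only [zero_add] at h1
    have h2 := ((hf.differentiable one_ne_zero) (x (T * t))).hasFDerivAt.comp_hasDerivAt t h1
    refine h2.congr_deriv ?_
    simp [hB, hψdef]
  have hΨ0 : (fun t => Φ (T * t)) 0 = ContinuousLinearMap.id ℝ E := by simp [hΦ0]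
  have hΨ : ∀ t, HasDerivAt (fun t => Φ (T * t)) ((B t).comp (Φ (T * t))) t := fun t => by
    have h1 : HasDerivAt (fun t => T * t) T t := by simpa using (hasDerivAt_id t).const_mul T
    refine ((hΦ (T * t)).scomp t h1).congr_deriv ?_
    ext v; simp [hB]
  -- If the velocity vanished once, it would vanish always, and the orbit would be constant.
  have hψne : ψ 0 ≠ 0 := by
    intro h0
    have hz : ∀ t, ψ t = 0 := fun t => by
      rw [eq_fundamental_apply hL hΨ0 hΨ hψ t, h0, map_zero]
    have hT := h.orbit.pos.ne'
    have hfx : ∀ s, f (x s) = 0 := fun s => by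
      have := hz (s / T)
      simp only [hψdef, mul_div_cancel₀ s hT] at this
      exact this
    obtain ⟨t, s, hts⟩ := h.orbit.nonconstant
    refine hts (is_const_of_deriv_eq_zero (fun r => (h.orbit.solves r).differentiableAt)
      (fun r => ?_) t s)
    rw [(h.orbit.solves r).deriv, hfx]
  obtain ⟨l, hl⟩ := SeparatingDual.exists_eq_one (R := ℝ) hψne
  refine ⟨l, by simpa [hψdef] using hl, restrictCurve B hBc, fun t => rfl, ?_⟩
  refine bijective_linearPeriodMap hBc hL hΨ0 hΨ (by simpa using hroot) hψ ?_
    (hf.continuous.comp hxc) hl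
  have := h.orbit.periodic 0
  simp only [hψdef, mul_one, mul_zero]
  rw [zero_add] at this
  rw [this]

/-- Persistence of hyperbolic periodic orbits under `C¹` small perturbations: near the orbit,
`periodMap` is uniformly expanding and has a zero. -/
theorem IsHyperbolicOrbit.exists_persistence {f : E → E} (hf : ContDiff ℝ 1 f) {x : ℝ → E} {T : ℝ}
    (h : IsHyperbolicOrbit f x T) :
    ∃ l : E →L[ℝ] ℝ, l (f (x 0)) = 1 ∧ ∃ K > 0, ∀ ρ₀ > 0, ∃ ρ > 0, ρ ≤ ρ₀ ∧ ∃ ε₀ > 0, ∃ Λ > 0,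
      ∀ p : C(E, E), (∀ z, ‖p z‖ ≤ ε₀) → LipschitzWith ε₀.toNNReal p →
        (∀ w₁ ∈ closedBall (h.orbit.unitCurve, T) ρ, ∀ w₂ ∈ closedBall (h.orbit.unitCurve, T) ρ,
          ‖w₁ - w₂‖ ≤ K * ‖periodMap l (l (x 0)) (⟨f, hf.continuous⟩ + p) w₁ -
            periodMap l (l (x 0)) (⟨f, hf.continuous⟩ + p) w₂‖) ∧
        (∃ w ∈ closedBall (h.orbit.unitCurve, T) ρ,
          periodMap l (l (x 0)) (⟨f, hf.continuous⟩ + p) w = 0) ∧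
        ∀ t, ∀ y ∈ closedBall (h.orbit.unitCurve t) ρ, ∀ z ∈ closedBall (h.orbit.unitCurve t) ρ,
          ‖(f y + p y) - (f z + p z)‖ ≤ Λ * ‖y - z‖ := by
  obtain ⟨l, hl, β, hβ, hbij⟩ := h.exists_bijective hf
  have hT := h.orbit.pos
  let A := ContinuousLinearEquiv.ofBijective _ (LinearMap.ker_eq_bot.2 hbij.1)
    (LinearMap.range_eq_top.2 hbij.2)
  have hA : ∀ w, A w = linearPeriodMap l β
    ((⟨f, hf.continuous⟩ : C(E, E)).comp h.orbit.unitCurve) w := fun w => rfl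
  obtain ⟨c, hc, K, hK, hpert⟩ := A.exists_perturbation_bounds
  have hfc : Continuous (fderiv ℝ f) := hf.continuous_fderiv one_ne_zero
  set D : C(unitInterval, E →L[ℝ] E) :=
    ⟨fun t => fderiv ℝ f (h.orbit.unitCurve t), hfc.comp h.orbit.unitCurve.continuous⟩ with hD
  have hL : ∀ t, ‖fderiv ℝ f (h.orbit.unitCurve t)‖ ≤ ‖D‖ := fun t => D.norm_coe_le_norm t
  refine ⟨l, hl, K, hK, fun ρ₀ hρ₀ => ?_⟩
  set m : ℝ := min 1 (c / (2 * ‖D‖ + 2 * T + 4)) with hm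
  have hden : 0 < 2 * ‖D‖ + 2 * T + 4 := by positivity
  have hm0 : 0 < m := lt_min one_pos (div_pos hc hden)
  have hmc : (2 * ‖D‖ + 2 * T + 4) * m ≤ c := by
    rw [← le_div_iff₀' hden]; exact min_le_right _ _
  obtain ⟨ρ₁, hρ₁, hstrict⟩ :=
    (isCompact_range h.orbit.unitCurve.continuous).exists_uniform_strict_fderiv hf hm0
  set ρ := min ρ₀ (min ρ₁ m) with hρ
  have hρ0 : 0 < ρ := lt_min hρ₀ (lt_min hρ₁ hm0)
  have hρ1 : ρ ≤ ρ₁ := (min_le_right _ _).trans (min_le_left _ _)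
  have hρm : ρ ≤ m := (min_le_right _ _).trans (min_le_right _ _)
  have hstrict' : ∀ t, ∀ y ∈ closedBall (h.orbit.unitCurve t) ρ,
      ∀ z ∈ closedBall (h.orbit.unitCurve t) ρ,
      ‖f y - f z - fderiv ℝ f (h.orbit.unitCurve t) (y - z)‖ ≤ m * ‖y - z‖ := fun t y hy z hz =>
    hstrict _ ⟨t, rfl⟩ y (closedBall_subset_closedBall hρ1 hy) z
      (closedBall_subset_closedBall hρ1 hz)
  -- The bound ρ / (K T) makes K times the value at the unperturbed orbit, at most K T ε₀, no larger
  -- than ρ.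
  set ε₀ := min m (ρ / (K * T)) with hε
  have hε₀ : 0 < ε₀ := lt_min hm0 (by positivity)
  refine ⟨ρ, hρ0, min_le_left _ _, ε₀, hε₀, m + ‖D‖ + ε₀, by positivity, fun p hp hp' => ?_⟩
  have hpm : ∀ z, ‖p z‖ ≤ m := fun z => (hp z).trans (min_le_left _ _)
  have hpm' : LipschitzWith m.toNNReal p :=
    hp'.weaken (Real.toNNReal_le_toNNReal (min_le_left _ _))
  obtain ⟨h1, h2⟩ := hpert (periodMap l (l (x 0)) (⟨f, hf.continuous⟩ + p)) (h.orbit.unitCurve, T)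
    ρ hρ0.le (fun w₁ hw₁ w₂ hw₂ => by
      rw [hA]
      refine (norm_periodMap_sub_sub_le hf.continuous hT hβ hL (min_le_left _ _) hm0.le hρm
        hstrict' hpm hpm' hw₁ hw₂).trans ?_
      gcongr)
  refine ⟨h1, h2 ?_, fun t y hy z hz => ?_⟩
  · have := norm_periodMap_orbit_le hf.continuous h.orbit l p hp
    calc K * _ ≤ K * (T * ε₀) := by gcongr
      _ ≤ K * (T * (ρ / (K * T))) := by gcongr; exact min_le_right _ _
      _ = ρ := by field_simp
  · have e1 := hstrict' t y hy z hz
    have e2 := ((fderiv ℝ f (h.orbit.unitCurve t)).le_opNorm (y - z)).trans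
      (mul_le_mul_of_nonneg_right (hL t) (norm_nonneg _))
    have e3 := hp'.dist_le_mul y z
    rw [dist_eq_norm, dist_eq_norm, Real.coe_toNNReal _ hε₀.le] at e3
    have e4 : (f y + p y) - (f z + p z) = (f y - f z - fderiv ℝ f (h.orbit.unitCurve t) (y - z)) +
      fderiv ℝ f (h.orbit.unitCurve t) (y - z) + (p y - p z) := by abel
    rw [e4]
    refine (norm_add₃_le).trans ?_
    linarith

end Persistence

/-! ### Zeros of the period map and periodic orbits -/

section ZerosAndOrbits

theorem Function.Periodic.map_fract {F : Type*} {φ : ℝ → F} (h : Function.Periodic φ 1) (t : ℝ) :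
    φ (Int.fract t) = φ t := by
  have := h.sub_zsmul_eq (x := t) ⌊t⌋
  rwa [zsmul_one] at this

/-- Two curves of period one are close if they are close on the unit interval. -/
theorem Function.Periodic.norm_sub_lt {E : Type*} [NormedAddCommGroup E] {u v : ℝ → E} (hu : Function.Periodic u 1)
    (hv : Function.Periodic v 1) {δ : ℝ} (h : ∀ t : unitInterval, ‖u t - v t‖ < δ) (t : ℝ) :
    ‖u t - v t‖ < δ := by
  rw [← hu.map_fract, ← hv.map_fract]
  exact h ⟨Int.fract t, Int.fract_nonneg t, (Int.fract_lt_one t).le⟩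

variable {E : Type*} [NormedAddCommGroup E] [NormedSpace ℝ E]

theorem IsPeriodicOrbit.periodic_rescaled {g : E → E} {y : ℝ → E} {S : ℝ}
    (h : IsPeriodicOrbit g y S) (τ : ℝ) : Function.Periodic (fun t => y (τ + S * t)) 1 := fun t => by
  simp only [mul_add, mul_one, ← add_assoc, h.periodic]

/-- A zero of `periodMap` comes from a periodic orbit. -/
theorem exists_isPeriodicOrbit_of_periodMap_eq_zero [CompleteSpace E] {g : C(E, E)}
    {l : E →L[ℝ] ℝ} {a : ℝ} {u : C(unitInterval, E)} {S : ℝ} (h : periodMap l a g (u, S) = 0)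
    (hS : 0 < S) (hu : ∃ t s, u t ≠ u s) :
    ∃ y : ℝ → E, IsPeriodicOrbit g y S ∧ ∀ t : unitInterval, y (S * t) = u t := by
  have h1 : ∀ t : unitInterval, u t = u 1 + S • ∫ r in (0 : ℝ)..t, extendCurve (g.comp u) r :=
    fun t => by
      have := DFunLike.congr_fun (congrArg Prod.fst h) t
      simp only [periodMap, ContinuousMap.sub_apply, ContinuousMap.smul_apply,
        constantCurve_apply, primitive_apply, Prod.fst_zero, ContinuousMap.zero_apply] at this
      rw [sub_sub, sub_eq_zero] at this
      exact this
  -- Evaluation at 0 gives periodicity: the equation carries `u 1` in place of the initial value.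
  have h01 : u 0 = u 1 := by simpa using h1 0
  set v : ℝ → E := fun t => extendCurve u (Int.fract t) with hv
  have e0 : extendCurve u 0 = u 0 := extendCurve_coe u 0
  have e1 : extendCurve u 1 = u 1 := extendCurve_coe u 1
  have hvc : Continuous v :=
    (continuous_extendCurve u).continuousOn.comp_fract'' (by rw [e0, e1, h01])
  have hvp : Function.Periodic v 1 := fun t => by simp [hv]
  have hvu : ∀ t ∈ Icc (0 : ℝ) 1, v t = extendCurve u t := by
    intro t ht
    rcases eq_or_lt_of_le ht.2 with rfl | hlt
    · simp [hv, e0, e1, h01]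
    · simp only [hv, Int.fract_eq_self.2 ⟨ht.1, hlt⟩]
  -- `v` is so far only continuous. `W` is differentiable by construction, agrees with `v` on [0,
  -- 1], and has period 1 because the integral over one period vanishes; hence it equals `v`.
  set W : ℝ → E := fun t => v 0 + S • ∫ r in (0 : ℝ)..t, g (v r) with hW
  have hgc : Continuous fun r => g (v r) := g.continuous.comp hvc
  have hWv : ∀ t ∈ Icc (0 : ℝ) 1, W t = v t := by
    intro t ht
    have : ∀ r ∈ uIcc (0 : ℝ) t, g (v r) = extendCurve (g.comp u) r := by
      intro r hr
      rw [uIcc_of_le ht.1] at hr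
      have hr' : r ∈ Icc (0 : ℝ) 1 := ⟨hr.1, hr.2.trans ht.2⟩
      rw [hvu r hr', extendCurve_of_mem _ hr', extendCurve_of_mem _ hr', ContinuousMap.comp_apply]
    simp only [hW]
    rw [intervalIntegral.integral_congr this, hvu 0 ⟨le_rfl, zero_le_one⟩, e0, h01, hvu t ht,
      extendCurve_of_mem u ht]
    exact (h1 ⟨t, ht⟩).symm
  have hint : S • ∫ r in (0 : ℝ)..1, g (v r) = 0 := by
    have := hWv 1 ⟨zero_le_one, le_rfl⟩
    rw [hvu 1 ⟨zero_le_one, le_rfl⟩, e1, ← h01, ← e0, ← hvu 0 ⟨le_rfl, zero_le_one⟩] at this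
    simpa [hW] using this
  have hWp : Function.Periodic W 1 := by
    intro t
    have hper : Function.Periodic (fun r => g (v r)) 1 := fun r => by
      simp only [hvp r]
    have h2 := hper.intervalIntegral_add_eq t 0
    rw [zero_add] at h2
    simp only [hW]
    rw [← intervalIntegral.integral_add_adjacent_intervals (hgc.intervalIntegrable 0 t)
      (hgc.intervalIntegrable t (t + 1)), h2, smul_add, hint, add_zero]
  have hWeq : W = v := by
    ext t
    rw [← hWp.map_fract, ← hvp.map_fract]
    exact hWv _ ⟨Int.fract_nonneg t, (Int.fract_lt_one t).le⟩
  have hvd : ∀ t, HasDerivAt v (S • g (v t)) t := fun t => by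
    have : HasDerivAt W (S • g (v t)) t :=
      ((hgc.integral_hasStrictDerivAt 0 t).hasDerivAt.const_smul S).const_add (v 0)
    rwa [hWeq] at this
  have hval : ∀ t : unitInterval, v (S * t / S) = u t := fun t => by
    rw [mul_div_cancel_left₀ _ hS.ne', hvu t t.2, extendCurve_coe]
  refine ⟨fun t => v (t / S), ⟨hS, fun t => ?_, fun t => ?_, ?_⟩, hval⟩
  · have h2 : HasDerivAt (fun t => t / S) (1 / S) t := (hasDerivAt_id t).div_const S
    refine ((hvd (t / S)).scomp t h2).congr_deriv ?_
    rw [smul_smul, one_div, inv_mul_cancel₀ hS.ne', one_smul]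
  · simp only [add_div, div_self hS.ne']
    exact hvp _
  · obtain ⟨t, s, hts⟩ := hu
    exact ⟨S * t, S * s, by rwa [hval, hval]⟩

/-- Orbits with the same unit curve agree up to a time translation. -/
theorem IsPeriodicOrbit.eq_translate {g : E → E} {y y' : ℝ → E} {S : ℝ}
    (h : IsPeriodicOrbit g y S) (h' : IsPeriodicOrbit g y' S) {τ : ℝ}
    (heq : ∀ t : unitInterval, y' (τ + S * t) = y (S * t)) (t : ℝ) : y' t = y (t + -τ) := by
  have h1 := h.periodic_rescaled 0
  simp only [zero_add] at h1
  have h2 : ∀ t, y' (τ + S * t) = y (S * t) := fun t => by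
    have e1 := (h'.periodic_rescaled τ).map_fract t
    have e2 := h1.map_fract t
    rw [← e1, ← e2]
    exact heq ⟨Int.fract t, Int.fract_nonneg t, (Int.fract_lt_one t).le⟩
  have h3 := h2 ((t - τ) / S)
  rw [mul_div_cancel₀ _ h.pos.ne', add_sub_cancel] at h3
  rw [h3, sub_eq_add_neg]

/-- Every periodic orbit near a given one satisfies the phase condition after a small time
translation. -/
theorem IsPeriodicOrbit.exists_phase {f : E → E} {x : ℝ → E} {T : ℝ} (h : IsPeriodicOrbit f x T)
    {l : E →L[ℝ] ℝ} (hl : l (f (x 0)) = 1) {ρ : ℝ} (hρ : 0 < ρ) :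
    ∃ δ > 0, ∀ (g : E → E) (y : ℝ → E) (S : ℝ), IsPeriodicOrbit g y S → OrbitNear δ x T y S →
      ∃ (τ : ℝ) (u : C(unitInterval, E)), (∀ t, u t = y (τ + S * t)) ∧ l (u 0) = l (x 0) ∧
        (u, S) ∈ closedBall (h.unitCurve, T) ρ := by
  have hT := h.pos
  have hper := h.periodic_rescaled 0
  simp only [zero_add] at hper
  have hd0 := h.hasDerivAt_rescaled 0 0
  simp only [zero_add] at hd0
  set φ : ℝ → ℝ := fun r => l (x (T * r)) with hφ
  have hφ0 : φ 0 = l (x 0) := by simp [hφ]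
  -- The normalization of `l` gives the phase function slope T > 0, so it crosses its value at 0
  -- strictly upwards. A nearby orbit then attains that value at a time in [-r₀, r₀].
  have hφd : HasDerivAt φ T 0 := by
    refine (l.hasFDerivAt.comp_hasDerivAt 0 hd0).congr_deriv ?_
    simp [hl]
  have hslope : ∀ᶠ r in 𝓝[≠] (0 : ℝ), 0 < slope φ 0 r :=
    (hasDerivAt_iff_tendsto_slope.1 hφd).eventually (lt_mem_nhds hT)
  obtain ⟨r₁, hr₁, hsl⟩ := Metric.mem_nhdsWithin_iff.1 hslope
  obtain ⟨r₂, hr₂, hunif⟩ : ∃ r₂ > 0, ∀ t r, |r| < r₂ → ‖x (T * (t + r)) - x (T * t)‖ ≤ ρ / 2 := by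
    obtain ⟨r₂, hr₂, hunif⟩ := Metric.mem_uniformity_dist.1
      ((isCompact_Icc (a := (0 : ℝ)) (b := 1)).uniformContinuousAt_of_continuousAt
      (fun t => x (T * t)) (fun t _ => h.continuous_rescaled.continuousAt)
      (dist_mem_uniformity (half_pos hρ)))
    refine ⟨r₂, hr₂, fun t r hr => ?_⟩
    have h1 := hper.map_fract t
    have h2 : x (T * (t + r)) = x (T * (Int.fract t + r)) := by
      have := hper.sub_zsmul_eq (x := t + r) ⌊t⌋
      simp only [zsmul_eq_mul, mul_one] at this
      rw [← this, Int.fract]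
      congr 2
      ring
    have h3 := hunif (a := Int.fract t) (b := Int.fract t + r) (by
      rw [Real.dist_eq]; simpa using hr) ⟨Int.fract_nonneg t, (Int.fract_lt_one t).le⟩
    rw [h2, ← h1, ← dist_eq_norm, dist_comm]
    exact le_of_lt h3
  set r₀ := min r₁ r₂ / 2 with hr₀
  have hmin : 0 < min r₁ r₂ := lt_min hr₁ hr₂
  have hr₀pos : 0 < r₀ := by positivity
  have hr₀1 : r₀ < r₁ := (half_lt_self hmin).trans_le (min_le_left _ _)
  have hr₀2 : r₀ < r₂ := (half_lt_self hmin).trans_le (min_le_right _ _)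
  have hplus : φ 0 < φ r₀ := by
    have : 0 < slope φ 0 r₀ := hsl ⟨by simpa [abs_of_pos hr₀pos] using hr₀1, hr₀pos.ne'⟩
    rw [slope_def_field, sub_zero] at this
    have := (div_pos_iff_of_pos_right hr₀pos).1 this
    linarith
  have hminus : φ (-r₀) < φ 0 := by
    have : 0 < slope φ 0 (-r₀) :=
      hsl ⟨by simpa [abs_of_pos hr₀pos] using hr₀1, neg_ne_zero.2 hr₀pos.ne'⟩
    rw [slope_def_field, sub_zero, div_neg, ← neg_div] at this
    have := (div_pos_iff_of_pos_right hr₀pos).1 this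
    linarith
  set γ := min (φ r₀ - φ 0) (φ 0 - φ (-r₀)) with hγ
  have hγpos : 0 < γ := lt_min (by linarith) (by linarith)
  -- The second bound keeps `l` along the nearby orbit within γ of φ; the first, together with the
  -- time shift of at most r₀, keeps the curve within ρ/2 + ρ/2.
  refine ⟨min (ρ / 2) (γ / (‖l‖ + 1)), lt_min (half_pos hρ) (by positivity), ?_⟩
  rintro g y S hy ⟨hST, τ, hnear⟩
  have hlδ : ∀ r, |l (y (τ + S * r)) - φ r| ≤ γ := fun r => by
    rw [hφ, ← map_sub, ← Real.norm_eq_abs]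
    refine (l.le_opNorm _).trans ?_
    calc ‖l‖ * ‖y (τ + S * r) - x (T * r)‖ ≤ (‖l‖ + 1) * (γ / (‖l‖ + 1)) := by
          gcongr
          · linarith
          · exact (hnear r).le.trans (min_le_right _ _)
      _ = γ := by field_simp
  have hyc : Continuous fun r => l (y (τ + S * r)) :=
    l.continuous.comp (continuous_iff_continuousAt.2
      fun t => (hy.hasDerivAt_rescaled τ t).continuousAt)
  obtain ⟨r, hr, hrl⟩ : φ 0 ∈ (fun r => l (y (τ + S * r))) '' Icc (-r₀) r₀ := by
    refine intermediate_value_Icc (by linarith) hyc.continuousOn ⟨?_, ?_⟩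
    · have := (abs_le.1 (hlδ (-r₀))).2
      have : γ ≤ φ 0 - φ (-r₀) := min_le_right _ _
      linarith
    · have := (abs_le.1 (hlδ r₀)).1
      have : γ ≤ φ r₀ - φ 0 := min_le_left _ _
      linarith
  have huc : Continuous fun t => y (τ + S * r + S * t) :=
    continuous_iff_continuousAt.2 fun t => (hy.hasDerivAt_rescaled _ t).continuousAt
  refine ⟨τ + S * r, restrictCurve _ huc, fun t => rfl, ?_, ?_⟩
  · have : restrictCurve _ huc 0 = y (τ + S * r) := by
      change y (τ + S * r + S * ((0 : unitInterval) : ℝ)) = _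
      simp
    rw [this, ← hφ0]
    exact hrl
  · rw [← closedBall_prod_same, mem_prod, mem_closedBall, mem_closedBall, Real.dist_eq]
    refine ⟨(ContinuousMap.dist_le hρ.le).2 fun t => ?_, ?_⟩
    · have h1 : ‖y (τ + S * (t + r)) - x (T * (t + r))‖ ≤ ρ / 2 :=
        (hnear _).le.trans (min_le_left _ _)
      have h2 := hunif t r (abs_lt.2 ⟨by linarith [hr.1], by linarith [hr.2]⟩)
      rw [dist_eq_norm, h.unitCurve_apply]
      have h3 : restrictCurve _ huc t = y (τ + S * (t + r)) := by
        change y (τ + S * r + S * t) = _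
        congr 1; ring
      rw [h3, ← sub_add_sub_cancel _ (x (T * (t + r)))]
      exact (norm_add_le _ _).trans (by linarith)
    · have := hST.le.trans (min_le_left _ _)
      dsimp only
      linarith

end ZerosAndOrbits

/-! ### Making a steady observable oscillate -/

section Step

theorem continuous_integral_norm_extendCurve {E : Type*} [NormedAddCommGroup E] :
    Continuous fun u : C(unitInterval, E) => ∫ r in (0 : ℝ)..1, ‖extendCurve u r‖ := by
  refine intervalIntegral.continuous_parametric_intervalIntegral_of_continuous' ?_ 0 1
  have : Continuous fun w : C(unitInterval, E) × ℝ => ‖w.1 (projIcc 0 1 zero_le_one w.2)‖ :=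
    Continuous.norm (Continuous.eval continuous_fst (continuous_projIcc.comp continuous_snd))
  exact this

variable {E F : Type*} [NormedAddCommGroup E] [NormedSpace ℝ E] [NormedAddCommGroup F]
  [NormedSpace ℝ F]

/-- If a linear observable is constant along an orbit, the corresponding component of the vector
field vanishes there. -/
theorem IsPeriodicOrbit.map_eq_zero_of_steady {g : E → E} {y : ℝ → E} {S : ℝ}
    (h : IsPeriodicOrbit g y S) {u : C(unitInterval, E)} (hu : ∀ t : unitInterval, y (S * t) = u t)
    (π : E →L[ℝ] F) (hπ : ∀ t s, π (u t) = π (u s)) (t : unitInterval) : π (g (u t)) = 0 := by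
  have hper := h.periodic_rescaled 0
  simp only [zero_add] at hper
  have hconst : ∀ s, π (y s) = π (u 0) := fun s => by
    have h1 := hper.map_fract (s / S)
    simp only [mul_div_cancel₀ s h.pos.ne'] at h1
    rw [← h1]
    exact (congrArg π (hu ⟨_, Int.fract_nonneg _, (Int.fract_lt_one _).le⟩)).trans (hπ _ _)
  have h1 : HasDerivAt (fun s => π (y s)) (π (g (y (S * t)))) (S * t) :=
    π.hasFDerivAt.comp_hasDerivAt _ (h.solves (S * t))
  have h2 : HasDerivAt (fun s => π (y s)) 0 (S * t) := by
    simp only [hconst]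
    exact hasDerivAt_const _ _
  rw [← hu t]
  exact h1.unique h2

variable {l : E →L[ℝ] ℝ} {a : ℝ} {g q : C(E, E)}

/-- The displacement of a zero of `periodMap` under a perturbation of the vector field is controlled
by the mean of the perturbation along the orbit. -/
theorem norm_sub_le_integral_of_periodMap_eq_zero {s : Set (C(unitInterval, E) × ℝ)} {K : ℝ}
    (hK0 : 0 ≤ K)
    (hK : ∀ w₁ ∈ s, ∀ w₂ ∈ s, ‖w₁ - w₂‖ ≤ K * ‖periodMap l a g w₁ - periodMap l a g w₂‖)
    {w w₀ : C(unitInterval, E) × ℝ} (hw : w ∈ s) (hw₀ : w₀ ∈ s) (h₀ : periodMap l a g w₀ = 0)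
    {c : ℝ} (h : periodMap l a (g + c • q) w = 0) :
    ‖w - w₀‖ ≤ K * (|w.2| * (|c| * ∫ r in (0 : ℝ)..1, ‖extendCurve (q.comp w.1) r‖)) := by
  have h1 := periodMap_add_sub l a g (c • q) w
  have h2 : (c • q).comp w.1 = c • q.comp w.1 := rfl
  rw [h, zero_sub, h2, map_smul] at h1
  refine (hK w hw w₀ hw₀).trans ?_
  rw [h₀, sub_zero, ← norm_neg, h1, Prod.norm_mk, norm_neg, norm_zero,
    max_eq_left (norm_nonneg _), norm_smul, norm_smul, Real.norm_eq_abs, Real.norm_eq_abs]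
  gcongr
  exact norm_primitive_le_integral _

variable {v : C(unitInterval, E)} {T ρ K Λ : ℝ} {w : ℝ → C(unitInterval, E) × ℝ}
  {w₀ : C(unitInterval, E) × ℝ}

/-- The displacement is at most K (|T| + ρ) |c| Q, whichever zeros `w c` are chosen. -/
theorem tendsto_zeros_periodMap (hK0 : 0 ≤ K)
    (hK : ∀ w₁ ∈ closedBall (v, T) ρ, ∀ w₂ ∈ closedBall (v, T) ρ,
      ‖w₁ - w₂‖ ≤ K * ‖periodMap l a g w₁ - periodMap l a g w₂‖)
    {Q : ℝ} (hQ : ∀ z, ‖q z‖ ≤ Q) (hw₀ : w₀ ∈ closedBall (v, T) ρ) (h₀ : periodMap l a g w₀ = 0)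
    (hw : ∀ᶠ c in 𝓝[>] (0 : ℝ), w c ∈ closedBall (v, T) ρ ∧ periodMap l a (g + c • q) (w c) = 0) :
    Tendsto w (𝓝[>] 0) (𝓝 w₀) := by
  rw [tendsto_iff_norm_sub_tendsto_zero]
  have hQ0 : 0 ≤ Q := (norm_nonneg _).trans (hQ 0)
  have hlim : Tendsto (fun c : ℝ => K * ((|T| + ρ) * (|c| * Q))) (𝓝[>] 0) (𝓝 0) := by
    have : Continuous fun c : ℝ => K * ((|T| + ρ) * (|c| * Q)) := by fun_prop
    have := this.tendsto 0
    simp only [abs_zero, zero_mul, mul_zero] at this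
    exact this.mono_left nhdsWithin_le_nhds
  refine squeeze_zero' (Eventually.of_forall fun _ => norm_nonneg _) ?_ hlim
  filter_upwards [hw] with c hc
  refine (norm_sub_le_integral_of_periodMap_eq_zero hK0 hK hc.1 hw₀ h₀ hc.2).trans ?_
  have hρ : 0 ≤ ρ := dist_nonneg.trans hw₀
  have h2 : |(w c).2| ≤ |T| + ρ := by
    have h3 : dist (w c).2 T ≤ ρ := (le_max_right _ _).trans hc.1
    rw [Real.dist_eq] at h3
    have := abs_sub_abs_le_abs_sub (w c).2 T
    linarith
  have hI : 0 ≤ ∫ r in (0 : ℝ)..1, ‖extendCurve (q.comp (w c).1) r‖ :=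
    intervalIntegral.integral_nonneg zero_le_one fun _ _ => norm_nonneg _
  gcongr
  exact (integral_norm_extendCurve_le (q.comp (w c).1)).trans
    ((ContinuousMap.norm_le _ hQ0).2 fun t => hQ _)

/-- A perturbation that is large at one point of the orbit, as seen by a steady linear observable,
but small in the mean along the orbit, makes the observable oscillate. -/
theorem eventually_not_steady [CompleteSpace E] (hK0 : 0 ≤ K) (hT : ρ < T)
    (hK : ∀ w₁ ∈ closedBall (v, T) ρ, ∀ w₂ ∈ closedBall (v, T) ρ,
      ‖w₁ - w₂‖ ≤ K * ‖periodMap l a g w₁ - periodMap l a g w₂‖)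
    (hnc : ∀ u ∈ closedBall v ρ, ∃ t s, u t ≠ u s)
    (hΛ0 : 0 ≤ Λ) (hΛ : ∀ t, ∀ y ∈ closedBall (v t) ρ, ∀ z ∈ closedBall (v t) ρ,
      ‖g y - g z‖ ≤ Λ * ‖y - z‖)
    (hw₀ : w₀ ∈ closedBall (v, T) ρ) (h₀ : periodMap l a g w₀ = 0)
    (hw : ∀ᶠ c in 𝓝[>] (0 : ℝ), w c ∈ closedBall (v, T) ρ ∧ periodMap l a (g + c • q) (w c) = 0)
    (hlim : Tendsto w (𝓝[>] 0) (𝓝 w₀))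
    (π : E →L[ℝ] F) (hπ : ∀ z, ‖π z‖ ≤ ‖z‖) (hsteady : ∀ t s, π (w₀.1 t) = π (w₀.1 s))
    (t : unitInterval)
    (hq : Λ * K * (T + ρ) * ∫ r in (0 : ℝ)..1, ‖extendCurve (q.comp w₀.1) r‖ < ‖π (q (w₀.1 t))‖) :
    ∀ᶠ c in 𝓝[>] (0 : ℝ), ∃ t s, π ((w c).1 t) ≠ π ((w c).1 s) := by
  have hfst : Continuous fun w : C(unitInterval, E) × ℝ => w.1 := continuous_fst
  have hc1 : Continuous fun w : C(unitInterval, E) × ℝ =>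
      Λ * K * (T + ρ) * ∫ r in (0 : ℝ)..1, ‖extendCurve (q.comp w.1) r‖ :=
    continuous_const.mul
      (continuous_integral_norm_extendCurve.comp ((q.continuous_postcomp).comp hfst))
  have hc2 : Continuous fun w : C(unitInterval, E) × ℝ => ‖π (q (w.1 t))‖ :=
    (π.continuous.comp (q.continuous.comp ((continuous_eval_const t).comp hfst))).norm
  -- Both sides of `hq` are continuous in the curve, so the strict inequality survives along `w c`.
  have hev := ((hc1.tendsto w₀).comp hlim).eventually_lt ((hc2.tendsto w₀).comp hlim) hq
  have hzero : ∀ (g : C(E, E)) (w : C(unitInterval, E) × ℝ), w ∈ closedBall (v, T) ρ →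
      periodMap l a g w = 0 → (∀ t s, π (w.1 t) = π (w.1 s)) → π (g (w.1 t)) = 0 := by
    rintro g ⟨u, S⟩ hw h0 hst
    rw [← closedBall_prod_same, mem_prod, mem_closedBall, mem_closedBall, Real.dist_eq] at hw
    have hS : 0 < S := by linarith [(abs_le.1 hw.2).1]
    obtain ⟨y, hy, hyu⟩ := exists_isPeriodicOrbit_of_periodMap_eq_zero h0 hS (hnc u hw.1)
    exact hy.map_eq_zero_of_steady hyu π hst t
  filter_upwards [hev, hw, self_mem_nhdsWithin] with c hc hwc hcpos
  rw [mem_Ioi] at hcpos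
  by_contra! hst
  have h1 := hzero _ _ hwc.1 hwc.2 hst
  have h2 := hzero _ _ hw₀ h₀ hsteady
  have hdist := norm_sub_le_integral_of_periodMap_eq_zero hK0 hK hwc.1 hw₀ h₀ hwc.2
  have hb : ∀ w ∈ closedBall (v, T) ρ, w.1 t ∈ closedBall (v t) ρ := fun w hw =>
    mem_closedBall.2 ((ContinuousMap.dist_apply_le_dist t).trans ((le_max_left _ _).trans hw))
  have hS : |(w c).2| ≤ T + ρ := by
    have h3 : dist (w c).2 T ≤ ρ := (le_max_right _ _).trans hwc.1
    rw [Real.dist_eq, abs_le] at h3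
    rw [abs_le]
    constructor <;> linarith [h3.1, h3.2]
  have hI : 0 ≤ ∫ r in (0 : ℝ)..1, ‖extendCurve (q.comp (w c).1) r‖ :=
    intervalIntegral.integral_nonneg zero_le_one fun _ _ => norm_nonneg _
  have h3 : c * ‖π (q ((w c).1 t))‖ ≤
      c * (Λ * K * (T + ρ) * ∫ r in (0 : ℝ)..1, ‖extendCurve (q.comp (w c).1) r‖) := by
    -- Both observed velocities vanish at time t, so the new term is cancelled exactly by the change
    -- of `g` between the two orbits.
    have e1 : c • π (q ((w c).1 t)) = - π (g ((w c).1 t) - g (w₀.1 t)) := by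
      rw [map_sub, h2, sub_zero, eq_neg_iff_add_eq_zero, add_comm]
      simpa using h1
    calc c * ‖π (q ((w c).1 t))‖ = ‖c • π (q ((w c).1 t))‖ := by
          rw [norm_smul, Real.norm_eq_abs, abs_of_pos hcpos]
      _ ≤ ‖g ((w c).1 t) - g (w₀.1 t)‖ := by rw [e1, norm_neg]; exact hπ _
      _ ≤ Λ * ‖(w c).1 t - w₀.1 t‖ := hΛ t _ (hb _ hwc.1) _ (hb _ hw₀)
      _ ≤ Λ * ‖w c - w₀‖ := by
          gcongr
          exact (((w c).1 - w₀.1).norm_coe_le_norm t).trans (norm_fst_le (w c - w₀))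
      _ ≤ Λ * (K * (|(w c).2| * (|c| *
            ∫ r in (0 : ℝ)..1, ‖extendCurve (q.comp (w c).1) r‖))) := by gcongr
      _ ≤ Λ * (K * ((T + ρ) * (c *
            ∫ r in (0 : ℝ)..1, ‖extendCurve (q.comp (w c).1) r‖))) := by
          rw [abs_of_pos hcpos]; gcongr
      _ = _ := by ring
  have h4 := le_of_mul_le_mul_left h3 hcpos
  simp only [Function.comp_apply] at hc
  linarith

end Step

/-! ### Null level sets and narrow bumps -/

section Levels

/-- By connectedness the distance to `v s` takes every value between 0 and its positive value at `v
t`. -/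
theorem not_countable_range_of_ne {Y : Type*} [MetricSpace Y] {v : unitInterval → Y}
    (hv : Continuous v) {t s : unitInterval} (hts : v t ≠ v s) : ¬ (range v).Countable := by
  intro hc
  have h1 : ((fun y => dist y (v s)) '' range v).Countable := hc.image _
  have h2 : Icc 0 (dist (v t) (v s)) ⊆ (fun y => dist y (v s)) '' range v := by
    rw [← range_comp]
    have hpre : IsPreconnected (range ((fun y => dist y (v s)) ∘ v)) :=
      isPreconnected_range ((continuous_id.dist continuous_const).comp hv)
    exact hpre.Icc_subset ⟨s, by simp⟩ ⟨t, rfl⟩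
  exact (dist_pos.2 hts).not_ge (Cardinal.Real.Icc_countable_iff.1 (h1.mono h2))

/-- A nonconstant curve has a point that finitely many given curves meet in null sets only. -/
theorem exists_null_level {Y ι : Type*} [MetricSpace Y] [Finite ι] {κ : ι → ℝ → Y}
    (hκ : ∀ i, Continuous (κ i)) {v : unitInterval → Y} (hv : Continuous v)
    (hne : ∃ t s, v t ≠ v s) :
    ∃ t, ∀ i, (volume.restrict (Ioc (0 : ℝ) 1)) {r | κ i r = v t} = 0 := by
  obtain ⟨t, s, hts⟩ := hne
  by_contra! hcon
  -- Otherwise every value of `v` has, for some `i`, a level set of positive measure. For fixed `i`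
  -- these level sets are disjoint in a finite measure space, so there are only countably many such
  -- values.
  refine not_countable_range_of_ne hv hts (Countable.mono (s₂ := ⋃ i,
    {y | 0 < (volume.restrict (Ioc (0 : ℝ) 1)) (κ i ⁻¹' {y})}) ?_ ?_)
  · rintro _ ⟨t, rfl⟩
    obtain ⟨i, hi⟩ := hcon t
    exact mem_iUnion.2 ⟨i, pos_iff_ne_zero.2 hi⟩
  · refine countable_iUnion fun i => ?_
    refine Measure.countable_meas_pos_of_disjoint_iUnion
      (fun y => (isClosed_singleton.preimage (hκ i)).measurableSet) ?_
    intro y z hyz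
    exact (disjoint_singleton.2 hyz).preimage (κ i)

/-- The mean along a curve of narrow bump functions at a point tends to zero if the curve meets the
point in a null set only. -/
theorem tendsto_integral_bump {Y : Type*} [NormedAddCommGroup Y] [NormedSpace ℝ Y]
    [HasContDiffBump Y] {y : Y} {χ : ℕ → ContDiffBump y}
    (hχ : Tendsto (fun n => (χ n).rOut) atTop (𝓝 0)) {κ : ℝ → Y} (hκ : Continuous κ)
    (h0 : (volume.restrict (Ioc (0 : ℝ) 1)) {r | κ r = y} = 0) :
    Tendsto (fun n => ∫ r in (0 : ℝ)..1, χ n (κ r)) atTop (𝓝 0) := by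
  have hz : ∫ _ in Ioc (0 : ℝ) 1, (0 : ℝ) = 0 := by simp
  simp only [intervalIntegral.integral_of_le zero_le_one]
  have hint : Integrable (fun _ : ℝ => (1 : ℝ)) (volume.restrict (Ioc (0 : ℝ) 1)) :=
    integrable_const _
  suffices Tendsto (fun n => ∫ r in Ioc (0 : ℝ) 1, χ n (κ r)) atTop
      (𝓝 (∫ _ in Ioc (0 : ℝ) 1, (0 : ℝ))) by rwa [hz] at this
  refine tendsto_integral_of_dominated_convergence (F := fun n r => χ n (κ r))
    (f := fun _ => (0 : ℝ)) (fun _ => (1 : ℝ)) (fun n => ?_) hint (fun n => ?_) ?_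
  · exact ((χ n).continuous.comp hκ).aestronglyMeasurable
  · refine Eventually.of_forall fun r => ?_
    rw [Real.norm_eq_abs, abs_of_nonneg (χ n).nonneg]
    exact (χ n).le_one
  · have : ∀ᵐ r ∂(volume.restrict (Ioc (0 : ℝ) 1)), κ r ≠ y := by
      rw [ae_iff]; simpa using h0
    filter_upwards [this] with r hr
    refine tendsto_const_nhds.congr' ?_
    filter_upwards [hχ.eventually (gt_mem_nhds (dist_pos.2 hr))] with n hn
    exact ((χ n).zero_of_le_dist hn.le).symm

end Levels

/-! ### Estimates for the C¹ norm -/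

section SmallMaps

variable {E : Type*} [NormedAddCommGroup E] [NormedSpace ℝ E]

theorem norm_le_of_c1Norm_lt {p : E → E} {ε : ℝ} (hε : 0 ≤ ε) (h : c1Norm p < ENNReal.ofReal ε)
    (z : E) : ‖p z‖ ≤ ε := by
  have h1 : ‖p z‖ₑ ≤ c1Norm p :=
    (le_max_left _ _).trans (le_iSup (fun x => max ‖p x‖ₑ ‖fderiv ℝ p x‖ₑ) z)
  have h2 := h1.trans h.le
  rwa [← ofReal_norm, ENNReal.ofReal_le_ofReal_iff hε] at h2

theorem lipschitzWith_of_c1Norm_lt {p : E → E} {ε : ℝ} (hε : 0 ≤ ε) (hp : Differentiable ℝ p)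
    (h : c1Norm p < ENNReal.ofReal ε) : LipschitzWith ε.toNNReal p := by
  refine lipschitzWith_of_nnnorm_fderiv_le hp fun z => ?_
  have h1 : ‖fderiv ℝ p z‖ₑ ≤ c1Norm p :=
    (le_max_right _ _).trans (le_iSup (fun x => max ‖p x‖ₑ ‖fderiv ℝ p x‖ₑ) z)
  have h2 := h1.trans h.le
  rw [← ofReal_norm, ENNReal.ofReal_le_ofReal_iff hε] at h2
  rw [← NNReal.coe_le_coe, coe_nnnorm, Real.coe_toNNReal _ hε]
  exact h2

theorem c1Norm_zero : c1Norm (0 : E → E) = 0 := by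
  have : fderiv ℝ (0 : E → E) = 0 := by
    ext1 z
    exact fderiv_const_apply (0 : E)
  simp [c1Norm, this]

theorem c1Norm_add_smul_le {p q : E → E} (hp : Differentiable ℝ p) (hq : Differentiable ℝ q)
    (c : ℝ) : c1Norm (p + c • q) ≤ c1Norm p + ‖c‖ₑ * c1Norm q := by
  refine iSup_le fun z => max_le ?_ ?_
  · have h1 : ‖p z‖ₑ ≤ c1Norm p :=
      (le_max_left _ _).trans (le_iSup (fun x => max ‖p x‖ₑ ‖fderiv ℝ p x‖ₑ) z)
    have h2 : ‖q z‖ₑ ≤ c1Norm q :=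
      (le_max_left _ _).trans (le_iSup (fun x => max ‖q x‖ₑ ‖fderiv ℝ q x‖ₑ) z)
    refine (enorm_add_le _ _).trans (add_le_add h1 ?_)
    rw [Pi.smul_apply, enorm_smul]
    gcongr
  · have h1 : ‖fderiv ℝ p z‖ₑ ≤ c1Norm p :=
      (le_max_right _ _).trans (le_iSup (fun x => max ‖p x‖ₑ ‖fderiv ℝ p x‖ₑ) z)
    have h2 : ‖fderiv ℝ q z‖ₑ ≤ c1Norm q :=
      (le_max_right _ _).trans (le_iSup (fun x => max ‖q x‖ₑ ‖fderiv ℝ q x‖ₑ) z)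
    rw [fderiv_add (hp z) ((hq z).const_smul c), fderiv_const_smul (hq z)]
    refine (enorm_add_le _ _).trans (add_le_add h1 ?_)
    rw [enorm_smul]
    gcongr

theorem c1Norm_lt_top_of_lipschitzWith {q : E → E} {Q : ℝ} (hQ : ∀ z, ‖q z‖ ≤ Q) {L : NNReal}
    (hL : LipschitzWith L q) : c1Norm q < ⊤ := by
  refine lt_of_le_of_lt (iSup_le fun z => ?_) (b := ENNReal.ofReal (max Q L)) ENNReal.ofReal_lt_top
  rw [← ofReal_norm, ← ofReal_norm]
  refine max_le ?_ ?_ <;> refine ENNReal.ofReal_le_ofReal ?_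
  · exact (hQ z).trans (le_max_left _ _)
  · exact (norm_fderiv_le_of_lipschitz ℝ hL).trans (le_max_right _ _)

theorem eventually_c1Norm_add_smul_lt {p q : E → E} (hp : Differentiable ℝ p)
    (hq : Differentiable ℝ q) {ε : ℝ} (h : c1Norm p < ENNReal.ofReal ε) (hq' : c1Norm q < ⊤) :
    ∀ᶠ c in 𝓝[>] (0 : ℝ), c1Norm (p + c • q) < ENNReal.ofReal ε := by
  have h1 : Tendsto (fun c : ℝ => c1Norm p + ‖c‖ₑ * c1Norm q) (𝓝[>] 0) (𝓝 (c1Norm p)) := by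
    have h2 : Tendsto (fun c : ℝ => ‖c‖ₑ) (𝓝[>] 0) (𝓝 0) := by
      have := (continuous_enorm (E := ℝ)).tendsto 0
      rw [enorm_zero] at this
      exact this.mono_left nhdsWithin_le_nhds
    have h3 := ENNReal.Tendsto.mul_const h2 (b := c1Norm q) (Or.inr hq'.ne)
    simpa using (tendsto_const_nhds (x := c1Norm p)).add h3
  filter_upwards [h1.eventually (gt_mem_nhds h)] with c hc
  exact (c1Norm_add_smul_le hp hq c).trans_lt hc

end SmallMaps

/-! ### Input isomorphisms and symmetrized admissible maps -/

namespace Network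

variable {C A : Type*} {G : Network C A}

instance [Finite A] (c : C) : Finite (G.InputSet c) :=
  inferInstanceAs (Finite {a : A // G.head a = c})

noncomputable instance [Finite A] (c : C) : Fintype (G.InputSet c) := Fintype.ofFinite _

theorem InputIso.toEquiv_injective (c d : C) :
    Function.Injective (InputIso.toEquiv : G.InputIso c d → (G.InputSet c ≃ G.InputSet d)) := by
  rintro ⟨_, _, _⟩ ⟨_, _, _⟩ h
  cases h
  rfl

instance [Finite A] (c d : C) : Finite (G.InputIso c d) :=
  Finite.of_injective _ (InputIso.toEquiv_injective c d)

noncomputable instance [Finite A] (c d : C) : Fintype (G.InputIso c d) := Fintype.ofFinite _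

/-- The identity input isomorphism. -/
def InputIso.refl (c : C) : G.InputIso c c :=
  ⟨Equiv.refl _, G.nodeType.refl c, fun a => G.arrowType.refl a.1⟩

/-- The inverse of an input isomorphism. -/
def InputIso.symm {c d : C} (β : G.InputIso c d) : G.InputIso d c :=
  ⟨β.toEquiv.symm, G.nodeType.symm β.node_rel, fun a => by
    have := β.arrow_rel (β.toEquiv.symm a)
    rw [Equiv.apply_symm_apply] at this
    exact G.arrowType.symm this⟩

/-- The composition of input isomorphisms. -/
def InputIso.trans {c d e : C} (β : G.InputIso c d) (γ : G.InputIso d e) : G.InputIso c e :=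
  ⟨β.toEquiv.trans γ.toEquiv, G.nodeType.trans β.node_rel γ.node_rel, fun a =>
    G.arrowType.trans (β.arrow_rel a) (γ.arrow_rel (β.toEquiv a))⟩

/-- Composition with a fixed input isomorphism. -/
def InputIso.transRight (c : C) {d e : C} (γ : G.InputIso d e) :
    G.InputIso c d ≃ G.InputIso c e where
  toFun β := β.trans γ
  invFun β := β.trans γ.symm
  left_inv β := InputIso.toEquiv_injective _ _ (by
    ext a : 1; exact γ.toEquiv.symm_apply_apply _)
  right_inv β := InputIso.toEquiv_injective _ _ (by
    ext a : 1; exact γ.toEquiv.apply_symm_apply _)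

namespace NodeSpaces

variable (V : G.NodeSpaces)

theorem ident_ident {c d e : C} (h₁ : G.StateEquiv c d) (h₂ : G.StateEquiv d e)
    (h₃ : G.StateEquiv c e) (v : V.P c) : V.ident h₂ (V.ident h₁ v) = V.ident h₃ v := by
  ext i
  rfl

theorem ident_symm {c d : C} (h : G.StateEquiv c d) : (V.ident h).symm = V.ident h.symm := by
  ext v i
  rfl

theorem ident_self {c : C} (h : G.StateEquiv c c) (v : V.P c) : V.ident h v = v := by
  ext i
  rfl

/-- The space of the states of a node and of the tails of its input arrows. -/
abbrev InputSpace (c : C) : Type _ := V.P c × (∀ a : G.InputSet c, V.P a.tail)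

/-- The input state of the node `d`, transported to the node `c` by an input isomorphism. -/
noncomputable def pull {c d : C} (β : G.InputIso c d) : V.State →L[ℝ] V.InputSpace c :=
  (((V.ident (.head β)).symm.toContinuousLinearEquiv : V.P d →L[ℝ] V.P c).comp
    (ContinuousLinearMap.proj d)).prod
  (ContinuousLinearMap.pi fun a =>
    ((V.ident (.tail β a)).symm.toContinuousLinearEquiv :
      V.P (β.toEquiv a).tail →L[ℝ] V.P a.tail).comp (ContinuousLinearMap.proj _))

theorem pull_apply {c d : C} (β : G.InputIso c d) (x : V.State) :
    V.pull β x = ((V.ident (.head β)).symm (x d),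
      fun a => (V.ident (.tail β a)).symm (x (β.toEquiv a).tail)) := rfl

theorem pull_refl (c : C) (x : V.State) :
    V.pull (InputIso.refl c) x = (x c, fun a : G.InputSet c => x a.tail) := by
  rw [pull_apply]
  refine Prod.ext ?_ ?_
  · rw [ident_symm, ident_self]
  · funext a
    ext i
    rfl

theorem IsAdmissible.add_smul {f g : V.State → V.State} (hf : V.IsAdmissible f)
    (hg : V.IsAdmissible g) (s : ℝ) : V.IsAdmissible (f + s • g) := by
  obtain ⟨f', hf, hf'⟩ := hf
  obtain ⟨g', hg, hg'⟩ := hg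
  refine ⟨fun c y z => f' c y z + s • g' c y z, fun c x => ?_, fun c d β x => ?_⟩
  · dsimp only
    rw [← hf, ← hg]
    rfl
  · dsimp only
    rw [map_add, map_smul, hf', hg']

theorem isAdmissible_zero : V.IsAdmissible 0 :=
  ⟨fun _ _ _ => 0, fun _ _ => rfl, fun _ _ _ _ => by simp⟩

theorem isPerturbation_zero [Fintype C] {ε : ℝ} (hε : 0 < ε) : V.IsPerturbation 0 ε :=
  ⟨V.isAdmissible_zero, contDiff_zero_fun, by rw [c1Norm_zero]; simpa using hε⟩

variable [Finite A]

/-- The admissible map whose components at the nodes input isomorphic to `c` are the symmetrization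
of the function `χ` of the input state of `c`, times a fixed vector. -/
noncomputable def symmetrizedField {c : C} (χ : V.InputSpace c → ℝ) (e : V.P c) :
    V.State → V.State :=
  fun x d => ∑ β : G.InputIso c d, χ (V.pull β x) • V.ident (.head β) e

/-- Pulling back along γ composes every β with γ, and this composition is a bijection between the
index sets of the two sums. -/
theorem isAdmissible_symmetrizedField {c : C} (χ : V.InputSpace c → ℝ) (e : V.P c) :
    V.IsAdmissible (V.symmetrizedField χ e) := by
  refine ⟨fun d y z => ∑ β : G.InputIso c d, χ ((V.ident (.head β)).symm y,
    fun a => (V.ident (.tail β a)).symm (z (β.toEquiv a))) • V.ident (.head β) e,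
    fun d x => rfl, fun d d' γ x => ?_⟩
  dsimp only
  rw [map_sum, ← Equiv.sum_comp (InputIso.transRight c γ)]
  refine Finset.sum_congr rfl fun β _ => ?_
  rw [map_smul, ident_ident V (.head β) (.head γ) (.head (β.trans γ))]
  congr 2

variable {V} {c : C}

/-- In the component `c` all summands are nonnegative multiples of the same vector `e`, because
identifications of `V.P c` with itself are trivial. Nothing cancels, so the summand of the identity
is a lower bound. -/
theorem le_norm_symmetrizedField {χ : V.InputSpace c → ℝ} (hχ : ∀ z, 0 ≤ χ z) {e : V.P c}
    (he : ‖e‖ = 1) (x : V.State) :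
    χ (V.pull (InputIso.refl c) x) ≤ ‖V.symmetrizedField χ e x c‖ := by
  have h1 : V.symmetrizedField χ e x c = (∑ β : G.InputIso c c, χ (V.pull β x)) • e := by
    simp only [symmetrizedField, ident_self, Finset.sum_smul]
  rw [h1, norm_smul, he, mul_one, Real.norm_eq_abs,
    abs_of_nonneg (Finset.sum_nonneg fun β _ => hχ _)]
  exact Finset.single_le_sum (f := fun β : G.InputIso c c => χ (V.pull β x))
    (fun β _ => hχ _) (Finset.mem_univ _)

variable [Fintype C]

theorem contDiff_symmetrizedField {χ : V.InputSpace c → ℝ} (hχ : ContDiff ℝ ∞ χ) (e : V.P c) :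
    ContDiff ℝ ∞ (V.symmetrizedField χ e) := by
  refine contDiff_pi.2 fun d => ContDiff.sum fun β _ => ?_
  exact (hχ.comp (V.pull β).contDiff).smul contDiff_const

/-- The field depends only on input states and need not have compact support on the state space; its
bounds come from those of χ and from the operator norms of the finitely many maps `V.pull β`. -/
theorem c1Norm_symmetrizedField_lt_top {χ : V.InputSpace c → ℝ} (hχ : ContDiff ℝ ∞ χ)
    (hc : HasCompactSupport χ) (e : V.P c) : c1Norm (V.symmetrizedField χ e) < ⊤ := by
  obtain ⟨L, hL⟩ := hχ.lipschitzWith_of_hasCompactSupport hc (by simp)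
  obtain ⟨B, hB⟩ := hc.exists_bound_of_continuous hχ.continuous
  have hB0 : 0 ≤ B := (norm_nonneg _).trans (hB 0)
  refine c1Norm_lt_top_of_lipschitzWith
    (Q := ∑ d, ∑ _β : G.InputIso c d, B * ‖e‖) (L := ∑ d, ∑ β : G.InputIso c d,
      L * ‖V.pull β‖₊ * ‖e‖₊) (fun z => ?_) (LipschitzWith.of_dist_le_mul fun y z => ?_)
  · refine (pi_norm_le_iff_of_nonneg (by positivity)).2 fun d => ?_
    refine le_trans ?_ (Finset.single_le_sum (f := fun d => ∑ _β : G.InputIso c d, B * ‖e‖)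
      (fun d _ => by positivity) (Finset.mem_univ d))
    refine norm_sum_le_of_le _ fun β _ => ?_
    rw [norm_smul, LinearIsometryEquiv.norm_map]
    gcongr
    exact hB _
  · refine (dist_pi_le_iff (by positivity)).2 fun d => ?_
    push_cast
    have h1 : dist (V.symmetrizedField χ e y d) (V.symmetrizedField χ e z d) ≤
        ∑ β : G.InputIso c d, L * ‖V.pull β‖ * ‖e‖ * dist y z := by
      refine dist_sum_sum_le_of_le _ fun β _ => ?_
      rw [dist_eq_norm, ← sub_smul, norm_smul, LinearIsometryEquiv.norm_map, ← dist_eq_norm]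
      have h2 := hL.dist_le_mul (V.pull β y) (V.pull β z)
      have h3 : dist (V.pull β y) (V.pull β z) ≤ ‖V.pull β‖ * dist y z := by
        rw [dist_eq_norm, ← map_sub, dist_eq_norm]
        exact (V.pull β).le_opNorm _
      calc _ ≤ (L * (‖V.pull β‖ * dist y z)) * ‖e‖ := by
            gcongr
            exact h2.trans (by gcongr)
        _ = _ := by ring
    refine h1.trans ?_
    rw [← Finset.sum_mul]
    gcongr
    exact Finset.single_le_sum (f := fun d => ∑ β : G.InputIso c d, (L : ℝ) * ‖V.pull β‖ * ‖e‖)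
      (fun d _ => by positivity) (Finset.mem_univ d)

theorem norm_symmetrizedField_le {χ : V.InputSpace c → ℝ} (hχ : ∀ z, 0 ≤ χ z) {e : V.P c}
    (he : ‖e‖ = 1) (x : V.State) :
    ‖V.symmetrizedField χ e x‖ ≤ ∑ i : (Σ d, G.InputIso c d), χ (V.pull i.2 x) := by
  rw [Fintype.sum_sigma]
  have h0 : ∀ d, 0 ≤ ∑ β : G.InputIso c d, χ (V.pull β x) := fun d =>
    Finset.sum_nonneg fun β _ => hχ _
  refine (pi_norm_le_iff_of_nonneg (Finset.sum_nonneg fun d _ => h0 d)).2 fun d => ?_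
  refine le_trans ?_ (Finset.single_le_sum (fun d _ => h0 d) (Finset.mem_univ d))
  refine norm_sum_le_of_le _ fun β _ => ?_
  rw [norm_smul, LinearIsometryEquiv.norm_map, he, mul_one, Real.norm_eq_abs,
    abs_of_nonneg (hχ _)]

end NodeSpaces

end Network

/-! ### Closeness of orbits -/

section NearOrbits

variable {E : Type*} [NormedAddCommGroup E] [NormedSpace ℝ E]

/-- Orbits whose unit curves and periods are close are near each other. -/
theorem IsPeriodicOrbit.orbitNear {f g : E → E} {x y : ℝ → E} {T S δ : ℝ}
    (hx : IsPeriodicOrbit f x T) (hy : IsPeriodicOrbit g y S) {u : C(unitInterval, E)}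
    (hu : ∀ t : unitInterval, y (S * t) = u t) (h : ‖(u, S) - (hx.unitCurve, T)‖ < δ) :
    OrbitNear δ x T y S := by
  have h1 : ‖u - hx.unitCurve‖ < δ :=
    (norm_fst_le ((u, S) - (hx.unitCurve, T))).trans_lt h
  refine ⟨(norm_snd_le ((u, S) - (hx.unitCurve, T))).trans_lt h, 0, fun t => ?_⟩
  have hxp := hx.periodic_rescaled 0
  have hyp := hy.periodic_rescaled 0
  simp only [zero_add] at hxp hyp ⊢
  refine hyp.norm_sub_lt hxp (fun t => ?_) t
  rw [hu, ← hx.unitCurve_apply]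
  exact ((u - hx.unitCurve).norm_coe_le_norm t).trans_lt h1

theorem norm_le_toReal_c1Norm {p : E → E} (h : c1Norm p < ⊤) (z : E) :
    ‖p z‖ ≤ (c1Norm p).toReal + 1 := by
  refine norm_le_of_c1Norm_lt (by positivity) ?_ z
  rw [ENNReal.lt_ofReal_iff_toReal_lt h.ne]
  exact lt_add_one _

end NearOrbits

/-! ### Localized admissible perturbations -/

namespace Network

variable {C A : Type*} {G : Network C A}

/-- In a transitive network every proper nonempty set of nodes has an outgoing arrow. -/
theorem IsTransitive.exists_arrow (hG : G.IsTransitive) {O : Set C} {c d : C} (hc : c ∈ O)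
    (hd : d ∉ O) : ∃ a : A, G.tail a ∈ O ∧ G.head a ∉ O := by
  by_contra! hcon
  refine hd ?_
  induction hG c d with
  | refl => exact hc
  | tail _ hstep ih =>
    obtain ⟨a, rfl, rfl⟩ := hstep
    by_contra h
    exact h (hcon a (by_contra fun h' => h' (by_contra fun h'' => h'' (ih h''))))

namespace NodeSpaces

variable {V : G.NodeSpaces}

theorem IsPerturbation.mono [Fintype C] {p : V.State → V.State} {ε ε' : ℝ}
    (h : V.IsPerturbation p ε) (hε : ε ≤ ε') : V.IsPerturbation p ε' :=
  ⟨h.admissible, h.smooth, h.small.trans_le (ENNReal.ofReal_le_ofReal hε)⟩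

/-- If some input of the node `c` oscillates, there is an admissible map that is large at one point
of the curve in the component `c`, and small in the mean along the curve. -/
theorem exists_localized_field [Fintype C] [Finite A] {c : C} (hV : 0 < V.dim c)
    (u : C(unitInterval, V.State)) (b : G.InputSet c) (hb : ∃ t s, u t b.tail ≠ u s b.tail)
    {M : ℝ} (hM : 0 ≤ M) : ∃ q : C(V.State, V.State), V.IsAdmissible q ∧ ContDiff ℝ ∞ q ∧ c1Norm q < ⊤ ∧
      ∃ t, M * ∫ r in (0 : ℝ)..1, ‖extendCurve (q.comp u) r‖ < ‖q (u t) c‖ := by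
  set e : V.P c := EuclideanSpace.single ⟨0, hV⟩ 1 with he
  have he1 : ‖e‖ = 1 := by simp [he]
  set κ : (Σ d, G.InputIso c d) → ℝ → V.InputSpace c :=
    fun i r => V.pull i.2 (extendCurve u r) with hκdef
  have hκ : ∀ i, Continuous (κ i) := fun i =>
    (V.pull i.2).continuous.comp (continuous_extendCurve u)
  -- The value must be negligible for all transported input curves, not just that of `c`, since
  -- symmetrization evaluates the bump along each of them.
  obtain ⟨t, ht⟩ := exists_null_level hκ
    (v := fun t => V.pull (InputIso.refl c) (u t))
    ((V.pull (InputIso.refl c)).continuous.comp u.continuous) (by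
      obtain ⟨t, s, hts⟩ := hb
      refine ⟨t, s, fun h => hts ?_⟩
      simp only [pull_refl, Prod.mk.injEq] at h
      exact congrFun h.2 b)
  set y₀ := V.pull (InputIso.refl c) (u t) with hy₀
  let χ : ℕ → ContDiffBump y₀ := fun n =>
    ⟨1 / ((n : ℝ) + 1) / 2, 1 / ((n : ℝ) + 1), by positivity, half_lt_self (by positivity)⟩
  have hlim : Tendsto (fun n => M * ∑ i, ∫ r in (0 : ℝ)..1, χ n (κ i r)) atTop (𝓝 0) := by
    have := (tendsto_finsetSum Finset.univ fun i _ => tendsto_integral_bump (χ := χ)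
      tendsto_one_div_add_atTop_nhds_zero_nat (hκ i) (ht i)).const_mul M
    simpa using this
  obtain ⟨n, hn⟩ := (hlim.eventually (gt_mem_nhds one_pos)).exists
  have hsm : ContDiff ℝ ∞ (χ n) := (χ n).contDiff
  have hnn : ∀ z, 0 ≤ χ n z := fun z => (χ n).nonneg
  have hq := contDiff_symmetrizedField hsm e
  refine ⟨⟨V.symmetrizedField (χ n) e, hq.continuous⟩, V.isAdmissible_symmetrizedField _ e, hq,
    c1Norm_symmetrizedField_lt_top hsm (χ n).hasCompactSupport e, t, ?_⟩
  have h1 : (1 : ℝ) ≤ ‖V.symmetrizedField (χ n) e (u t) c‖ := by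
    have := le_norm_symmetrizedField hnn he1 (u t)
    rwa [← hy₀, (χ n).one_of_mem_closedBall (mem_closedBall_self (χ n).rIn_pos.le)] at this
  refine lt_of_lt_of_le (lt_of_le_of_lt ?_ hn) h1
  refine mul_le_mul_of_nonneg_left ?_ hM
  have hci : ∀ i, Continuous fun r => χ n (κ i r) := fun i => (χ n).continuous.comp (hκ i)
  rw [← intervalIntegral.integral_finsetSum fun i _ => (hci i).intervalIntegrable _ _]
  refine intervalIntegral.integral_mono_on zero_le_one
    ((continuous_extendCurve _).norm.intervalIntegrable _ _)
    ((continuous_finsetSum _ fun i _ => hci i).intervalIntegrable _ _) fun r _ => ?_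
  exact norm_symmetrizedField_le hnn he1 (extendCurve u r)

end NodeSpaces

end Network

/-! ### Propagation of oscillation along an arrow -/

namespace Network

namespace NodeSpaces

variable {C A : Type*} [Fintype C] {G : Network C A} {V : G.NodeSpaces}

/-- The nodes that oscillate on a curve. -/
def oscillatingNodes (u : C(unitInterval, V.State)) : Set C := {c | ∃ t s, u t c ≠ u s c}

/-- Having different states at two fixed times is an open condition on the curve, and there are
finitely many nodes. -/
theorem eventually_oscillatingNodes_subset {w : ℝ → C(unitInterval, V.State) × ℝ}
    {w₀ : C(unitInterval, V.State) × ℝ} (hw : Tendsto w (𝓝[>] 0) (𝓝 w₀)) :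
    ∀ᶠ s in 𝓝[>] (0 : ℝ), oscillatingNodes w₀.1 ⊆ oscillatingNodes (w s).1 := by
  have h : ∀ c, ∀ᶠ s in 𝓝[>] (0 : ℝ), c ∈ oscillatingNodes w₀.1 →
      c ∈ oscillatingNodes (w s).1 := by
    intro c
    by_cases hc : c ∈ oscillatingNodes w₀.1
    · obtain ⟨t, s, hts⟩ := hc
      have hcont : ∀ t, Continuous fun w : C(unitInterval, V.State) × ℝ => w.1 t c := fun t =>
        (continuous_apply c).comp ((continuous_eval_const t).comp continuous_fst)
      have h1 : Tendsto (fun r => (w r).1 t c) (𝓝[>] 0) (𝓝 (w₀.1 t c)) :=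
        ((hcont t).tendsto w₀).comp hw
      have h2 : Tendsto (fun r => (w r).1 s c) (𝓝[>] 0) (𝓝 (w₀.1 s c)) :=
        ((hcont s).tendsto w₀).comp hw
      filter_upwards [(h1.sub h2).eventually_ne (sub_ne_zero.2 hts)] with r hr _
      exact ⟨t, s, sub_ne_zero.1 hr⟩
    · exact Eventually.of_forall fun _ h => absurd h hc
  filter_upwards [eventually_all.2 h] with s hs c hc using hs c hc

/-- A perturbation under which the oscillation propagates along an arrow, while oscillating nodes
keep oscillating. -/
theorem exists_perturbation_oscillating [Finite A] (hV : ∀ c, 0 < V.dim c)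
    {l : V.State →L[ℝ] ℝ} {a : ℝ} {f : C(V.State, V.State)} {v : C(unitInterval, V.State)}
    {T ρ K Λ ε : ℝ} (hρ : 0 < ρ) (hT : ρ < T) (hK0 : 0 ≤ K) (hΛ0 : 0 ≤ Λ)
    (hnc : ∀ u ∈ closedBall v ρ, ∃ t s, u t ≠ u s)
    (hK : ∀ p : C(V.State, V.State), V.IsPerturbation p ε →
      ∀ w₁ ∈ closedBall (v, T) ρ, ∀ w₂ ∈ closedBall (v, T) ρ,
        ‖w₁ - w₂‖ ≤ K * ‖periodMap l a (f + p) w₁ - periodMap l a (f + p) w₂‖)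
    (hex : ∀ p : C(V.State, V.State), V.IsPerturbation p ε →
      ∃ w ∈ closedBall (v, T) ρ, periodMap l a (f + p) w = 0)
    (hΛ : ∀ p : C(V.State, V.State), V.IsPerturbation p ε →
      ∀ t, ∀ y ∈ closedBall (v t) ρ, ∀ z ∈ closedBall (v t) ρ,
        ‖(f + p) y - (f + p) z‖ ≤ Λ * ‖y - z‖)
    {p : C(V.State, V.State)} (hp : V.IsPerturbation p ε) {w₀ : C(unitInterval, V.State) × ℝ}
    (hw₀ : w₀ ∈ closedBall (v, T) ρ) (h₀ : periodMap l a (f + p) w₀ = 0) {b : A}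
    (hb : G.tail b ∈ oscillatingNodes w₀.1) (hb' : G.head b ∉ oscillatingNodes w₀.1) :
    ∃ p' : C(V.State, V.State), V.IsPerturbation p' ε ∧ ∃ w ∈ closedBall (v, T) ρ,
      periodMap l a (f + p') w = 0 ∧ oscillatingNodes w₀.1 ⊆ oscillatingNodes w.1 ∧
        G.head b ∈ oscillatingNodes w.1 := by
  obtain ⟨q, hqadm, hqs, hqc, t, ht⟩ := exists_localized_field (hV (G.head b)) w₀.1 ⟨b, rfl⟩ hb
    (M := Λ * K * (T + ρ)) (mul_nonneg (mul_nonneg hΛ0 hK0) (by linarith))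
  have hpert : ∀ᶠ s in 𝓝[>] (0 : ℝ), V.IsPerturbation (p + s • q : C(V.State, V.State)) ε := by
    filter_upwards [eventually_c1Norm_add_smul_lt (hp.smooth.differentiable (by simp))
      (hqs.differentiable (by simp)) hp.small hqc] with s hs
    exact ⟨hp.admissible.add_smul V hqadm s, hp.smooth.add (hqs.const_smul s), hs⟩
  -- For `s` outside the admitted range the value is the dummy `w₀`; only small positive `s` matter.
  have hchoice : ∀ s : ℝ, ∃ w, V.IsPerturbation (p + s • q : C(V.State, V.State)) ε →
      w ∈ closedBall (v, T) ρ ∧ periodMap l a (f + p + s • q) w = 0 := fun s => by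
    by_cases hs : V.IsPerturbation (p + s • q : C(V.State, V.State)) ε
    · obtain ⟨w, hw, h⟩ := hex _ hs
      exact ⟨w, fun _ => ⟨hw, by rwa [add_assoc]⟩⟩
    · exact ⟨w₀, fun h => absurd h hs⟩
  choose w hw using hchoice
  have hw' : ∀ᶠ s in 𝓝[>] (0 : ℝ),
      w s ∈ closedBall (v, T) ρ ∧ periodMap l a (f + p + s • q) (w s) = 0 :=
    hpert.mono fun s hs => hw s hs
  have hlim : Tendsto w (𝓝[>] 0) (𝓝 w₀) :=
    tendsto_zeros_periodMap hK0 (hK p hp) (norm_le_toReal_c1Norm hqc) hw₀ h₀ hw'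
  have hosc := eventually_not_steady hK0 hT (hK p hp) hnc hΛ0 (hΛ p hp) hw₀ h₀ hw' hlim
    (ContinuousLinearMap.proj (G.head b)) (fun z => norm_le_pi_norm z _) (fun t s => by
      by_contra h
      exact hb' ⟨t, s, h⟩) t ht
  obtain ⟨s, hs1, hs2, hs3⟩ :=
    (hpert.and (hosc.and (eventually_oscillatingNodes_subset hlim))).exists
  exact ⟨_, hs1, w s, (hw s hs1).1, by rw [← add_assoc]; exact (hw s hs1).2, hs3, hs2⟩

end NodeSpaces

end Network

/-! ### The full oscillation property -/

open Network NodeSpaces in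
/-- The full oscillation property, for hyperbolic periodic orbits. -/
theorem full_oscillation {C A : Type*} [Fintype C] [Finite A] (G : Network C A)
    (hG : G.IsTransitive) (V : G.NodeSpaces) (hV : ∀ c, 0 < V.dim c)
    (f : V.State → V.State) (hf : ContDiff ℝ ∞ f)
    (x : ℝ → V.State) (T : ℝ) (hX : IsHyperbolicOrbit f x T) :
    ∃ δ > 0, ∀ ε > 0, ∃ p, V.IsPerturbation p ε ∧
      ∃ y S, IsPeriodicOrbit (f + p) y S ∧ OrbitNear ε x T y S ∧ OrbitNear δ x T y S ∧
        (∀ y' S', IsPeriodicOrbit (f + p) y' S' → OrbitNear δ x T y' S' →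
          ∃ τ : ℝ, ∀ t, y' t = y (t + τ)) ∧
        ∀ c : C, ∃ t s : ℝ, y t c ≠ y s c := by
  obtain ⟨l, hl, K, hK, hpers⟩ := hX.exists_persistence (hf.of_le (by simp))
  have hT := hX.orbit.pos
  set v := hX.orbit.unitCurve with hv
  obtain ⟨t₁, t₂, ht⟩ : ∃ t s, v t ≠ v s := by
    obtain ⟨t, s, hts⟩ := hX.orbit.nonconstant
    have hper := hX.orbit.periodic_rescaled 0
    simp only [zero_add] at hper
    have hfr : ∀ r, v ⟨Int.fract (r / T), Int.fract_nonneg _, (Int.fract_lt_one _).le⟩ = x r :=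
      fun r => by
        refine (hper.map_fract (r / T)).trans ?_
        rw [mul_div_cancel₀ _ hT.ne']
    by_contra! hcon
    refine hts ?_
    rw [← hfr t, ← hfr s]
    exact hcon _ _
  have hd : 0 < ‖v t₁ - v t₂‖ := norm_pos_iff.2 (sub_ne_zero.2 ht)
  -- The bound T/2 keeps periods in the ball positive; a quarter of the distance between two points
  -- of the orbit keeps all curves in the ball nonconstant. Neither depends on ε, so δ can be fixed
  -- first.
  obtain ⟨ρ, hρ, hρle, ε₀, hε₀, Λ, hΛ, hpers⟩ :=
    hpers (min (T / 2) (‖v t₁ - v t₂‖ / 4)) (lt_min (by positivity) (by positivity))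
  have hρT : ρ < T := (hρle.trans (min_le_left _ _)).trans_lt (half_lt_self hT)
  have hnc : ∀ u ∈ closedBall v ρ, ∃ t s, u t ≠ u s := by
    intro u hu
    refine ⟨t₁, t₂, fun h => ?_⟩
    have h1 : ∀ t, ‖u t - v t‖ ≤ ‖v t₁ - v t₂‖ / 4 := fun t => by
      rw [← dist_eq_norm]
      exact (ContinuousMap.dist_apply_le_dist t).trans
        ((mem_closedBall.1 hu).trans (hρle.trans (min_le_right _ _)))
    have h2 : v t₁ - v t₂ = (u t₂ - v t₂) - (u t₁ - v t₁) := by rw [h]; abel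
    have h3 := norm_sub_le (u t₂ - v t₂) (u t₁ - v t₁)
    rw [← h2] at h3
    linarith [h1 t₁, h1 t₂]
  obtain ⟨δ, hδ, hphase⟩ := hX.orbit.exists_phase hl hρ
  refine ⟨δ, hδ, fun ε hε => ?_⟩
  set fc : C(V.State, V.State) := ⟨f, hf.continuous⟩ with hfc
  have hεδ : 0 < min ε δ := lt_min hε hδ
  -- Zeros lie within K T ε' of the unperturbed orbit; the factor 2 makes this strictly less than
  -- min ε δ.
  set ε' := min (min ε ε₀) (min ε δ / (2 * (K * T))) with hε'
  have hε'pos : 0 < ε' := lt_min (lt_min hε hε₀) (by positivity)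
  have hε'ε : ε' ≤ ε := (min_le_left _ _).trans (min_le_left _ _)
  have hε'ε₀ : ε' ≤ ε₀ := (min_le_left _ _).trans (min_le_right _ _)
  have hpers' := fun (p : C(V.State, V.State)) (hp : V.IsPerturbation p ε') =>
    hpers p (fun z => (norm_le_of_c1Norm_lt hε'pos.le hp.small z).trans hε'ε₀)
      ((lipschitzWith_of_c1Norm_lt hε'pos.le (hp.smooth.differentiable (by simp))
        hp.small).weaken (Real.toNNReal_le_toNNReal hε'ε₀))
  -- There are finitely many sets of nodes, so a maximal realizable set of oscillating nodes exists.
  obtain ⟨O, hO⟩ := (Set.toFinite {O : Set C | ∃ p : C(V.State, V.State), V.IsPerturbation p ε' ∧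
    ∃ w ∈ closedBall (v, T) ρ, periodMap l (l (x 0)) (fc + p) w = 0 ∧
      oscillatingNodes w.1 = O}).exists_maximal (by
    have hp : V.IsPerturbation (0 : C(V.State, V.State)) ε' := V.isPerturbation_zero hε'pos
    obtain ⟨w, hw, h⟩ := (hpers' 0 hp).2.1
    exact ⟨_, 0, hp, w, hw, h, rfl⟩)
  obtain ⟨⟨p, hp, ⟨u, S⟩, hw, h0, rfl⟩, hmax⟩ := hO
  have hu : u ∈ closedBall v ρ := mem_closedBall.2 ((le_max_left _ _).trans (mem_closedBall.1 hw))
  have hS : 0 < S := by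
    have : dist S T ≤ ρ := (le_max_right _ _).trans (mem_closedBall.1 hw)
    rw [Real.dist_eq] at this
    linarith [(abs_le.1 this).1]
  have hall : ∀ c, c ∈ oscillatingNodes u := by
    by_contra! hcon
    obtain ⟨d, hd⟩ := hcon
    obtain ⟨c, hc⟩ : ∃ c, c ∈ oscillatingNodes u := by
      obtain ⟨t, s, hts⟩ := hnc u hu
      obtain ⟨c, hc⟩ := Function.ne_iff.1 hts
      exact ⟨c, t, s, hc⟩
    obtain ⟨b, hb, hb'⟩ := hG.exists_arrow hc hd
    obtain ⟨p', hp', w, hw', h0', hsub, hmem⟩ := exists_perturbation_oscillating hV hρ hρT hK.le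
      hΛ.le hnc (fun p hp => (hpers' p hp).1) (fun p hp => (hpers' p hp).2.1)
      (fun p hp => (hpers' p hp).2.2) hp hw h0 hb hb'
    exact hb' (hmax ⟨p', hp', w, hw', h0', rfl⟩ hsub hmem)
  obtain ⟨y, hy, hyu⟩ := exists_isPeriodicOrbit_of_periodMap_eq_zero h0 hS (hnc u hu)
  have hdist : ‖(u, S) - (v, T)‖ < min ε δ := by
    have h1 := (hpers' p hp).1 _ hw _ (mem_closedBall_self hρ.le)
    rw [h0, zero_sub, norm_neg] at h1
    have h2 := norm_periodMap_orbit_le hf.continuous hX.orbit l p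
      (norm_le_of_c1Norm_lt hε'pos.le hp.small)
    calc ‖(u, S) - (v, T)‖ ≤ K * (T * ε') := h1.trans (by gcongr)
      _ ≤ K * (T * (min ε δ / (2 * (K * T)))) := by gcongr; exact min_le_right _ _
      _ = min ε δ / 2 := by field_simp
      _ < min ε δ := half_lt_self hεδ
  refine ⟨p, hp.mono hε'ε, y, S, hy, hX.orbit.orbitNear hy hyu (hdist.trans_le (min_le_left _ _)),
    hX.orbit.orbitNear hy hyu (hdist.trans_le (min_le_right _ _)), fun y' S' hy' hnear => ?_,
    fun c => ?_⟩
  -- After a time translation the other orbit satisfies the phase condition and lies in the ball,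
  -- where the expanding period map has at most one zero.
  · obtain ⟨τ, u', hu', hlu', hmem⟩ := hphase _ y' S' hy' hnear
    have h1 : periodMap l (l (x 0)) (fc + p) (u', S') = 0 :=
      IsPeriodicOrbit.periodMap_eq_zero (g := fc + p) hy' hu' hlu'
    have h2 := (hpers' p hp).1 _ hmem _ hw
    rw [h1, h0, sub_zero, norm_zero, mul_zero] at h2
    have h3 : (u', S') = (u, S) := sub_eq_zero.1 (norm_le_zero_iff.1 h2)
    rw [Prod.mk.injEq] at h3
    obtain ⟨rfl, rfl⟩ := h3
    exact ⟨-τ, hy.eq_translate hy' fun t => by rw [← hu', hyu]⟩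
  · obtain ⟨t, s, hts⟩ := hall c
    exact ⟨S * t, S * s, by rwa [hyu, hyu]⟩

end

theorem theorem12p3 {C A : Type*} [Fintype C] [Finite A] (G : Network C A) (hG : G.IsTransitive)
    (V : G.NodeSpaces) (hV : ∀ c, 0 < V.dim c)
    (f : V.State → V.State) (hf : ContDiff ℝ ∞ f) (hadm : V.IsAdmissible f)
    (x : ℝ → V.State) (T : ℝ) (hX : V.StronglyHyperbolic f x T) :
    ∃ δ > 0, ∀ ε > 0, ∃ p, V.IsPerturbation p ε ∧
      ∃ y S, IsPeriodicOrbit (f + p) y S ∧ OrbitNear ε x T y S ∧ OrbitNear δ x T y S ∧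
        (∀ y' S', IsPeriodicOrbit (f + p) y' S' → OrbitNear δ x T y' S' →
          ∃ τ : ℝ, ∀ t, y' t = y (t + τ)) ∧
        ∀ c : C, ∃ t s : ℝ, y t c ≠ y s c :=
  full_oscillation G hG V hV f hf x T hX.1
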